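/- **Setting.** There are $m\ge 1$ identical machines and $n$ jobs of weight one, listed in order of arrival; job $j$ has a real release time $r_j\ge 0$ (with $r_1\le r_2\le\dots\le r_n$) and an integer processing time $p_j\ge 1$. Put $P_{\max}=\max_j p_j$; it is not known to the mechanism. **Interval sequences.** Let $S_0=\langle 1\rangle$ and $S_k=S_{k-1}\,\|\,S_{k-1}\,\|\,\langle 2^k\rangle$ ($\|$ is concatenation), and let $S_\infty$ be the infinite sequence that has every $S_k$ as a prefix. For an integer $t\ge 0$ and $k\in\{0,1,\dots,\infty\}$ let $S_k(t)$ be the sequence of consecutive intervals, the first one starting at $t$, whose lengths are the entries of $S_k$. For a sequence $B$ of consecutive intervals let $b(B)$ be its start and, if it is finite, $e(B)$ its end. **Mechanism.** A configuration is a pair $(A,X)$, where the state $A=\langle A_1,\dots,A_\ell\rangle$ is a list of interval sequences $A_i=S_{k_i}(t_i)$ and $X$ is the set of occupied pairs (interval, machine). Initially $A$ is empty, with the convention $e(A_\ell)=0$, and $X=\emptyset$. Jobs are handled in order. All intervals have integer endpoints; job $j$ is served at the integer time $t=\lceil r_j\rceil$, as follows. * *Menu.* Let $\tau=A_1\|\dots\|A_\ell\|S_\infty(t)$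 if $t\ge e(A_\ell)$, and $\tau=A_1\|\dots\|A_{\ell-1}\|S_\infty(b(A_\ell))$ otherwise. Going through the intervals of $\tau$ that start at or after $t$, list the first interval that is unoccupied on at least one machine, then the first later such interval that is longer than it, then the first later such interval that is longer than that one, and so on. The menu consists of the pairs $(I,q)$ with $I$ listed and $q$ a machine on which $I$ is unoccupied. * *Choice.* Job $j$ picks a menu entry $([b,e],q)$ of least cost, ties being broken arbitrarily; the cost is $b+p_j$ if $e-b\ge p_j$ and $\infty$ otherwise. It starts at $b$, and its completion time is $c_j=b+p_j$; the whole interval counts as occupied on $q$. * *Update.* Add $([b,e],q)$ to $X$. Let $2^k=e-b$. If $A$ is nonempty and $e\le e(A_\ell)$, then $A$ is unchanged. Otherwise: if $t\ge e(A_\ell)$, append $S_k(t)$ to $A$; if $t<e(A_\ell)$, $A_\ell=S_d(t')$ and $k\le d$, append $S_k(e(A_\ell))$; if $t<e(A_\ell)$ and $k>d$, replace $A_\ell$ by $S_k(b(A_\ell))$. **Theorem.** There is an absolute constant $C>0$ such that for all $m\ge 1$, all $n$ and every input as above the mechanism has a run (every job finds a menu entry of least cost), and every run has the following properties. 1. It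 is $O(\log P_{\max})$-competitive against the optimal preemptive schedule: for every feasible preemptive schedule of the same jobs on $m$ machines (preemption at arbitrary real times and migration are allowed, but no job is processed on two machines at once or before its release), with completion times $C_1,\dots,C_n$, $$\sum_{j=1}^n c_j\ \le\ C\,(1+\log_2 P_{\max})\sum_{j=1}^n C_j .$$ 2. If moreover all release times are integers and all processing times are powers of two, then for every job $j$ $$c_j\ \le\ C\,(1+\log_2 P_{\max})\,c_j^*,$$ where $c_j^*$ is the completion time of $j$ in the SRPT schedule, which at every time processes the (at most $m$) released unfinished jobs of least remaining processing time, ties being broken in favour of the job that comes first in the input. -/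

import Mathlib

open scoped ENNReal

noncomputable section

namespace PromptScheduling

/-! ### Inputs -/

/-- `n` weight-one jobs, listed in order of arrival, with nonnegative real release times `r` and
positive integer processing times `p`. Job `j` of the text is index `j - 1` here. -/
structure Input (n : ℕ) where
  r : Fin n → ℝ
  p : Fin n → ℕ
  r_nonneg : ∀ j, 0 ≤ r j
  r_mono : Monotone r
  p_pos : ∀ j, 1 ≤ p j

/-- The largest processing time `P_max` (it is `0` only when there are no jobs). -/
def Input.pMax {n : ℕ} (σ : Input n) : ℕ := Finset.univ.sup σ.p

/-! ### The integer sequences `S_k`, `S_∞` and the interval sequences `S_k(t)`, `S_∞(t)` -/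

/-- `S_0 = ⟨1⟩` and `S_k = S_{k-1} ‖ S_{k-1} ‖ ⟨2^k⟩`. -/
def seqS : ℕ → List ℕ
  | 0 => [1]
  | k + 1 => seqS k ++ seqS k ++ [2 ^ (k + 1)]

/-- `S_∞`, indexed from `0`. The list `S_i` has length `2^(i+1) - 1 > i` and is a prefix of
`S_∞`, so the entry at position `i` can be read off from it. -/
def seqInf (i : ℕ) : ℕ := (seqS i).getD i 0

/-- `γ_i`, the sum of the first `i` entries of `S_∞`. -/
def gam (i : ℕ) : ℕ := ∑ j ∈ Finset.range i, seqInf j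

/-- A time interval `[b, e]` with integer endpoints. -/
structure Slot where
  b : ℕ
  e : ℕ

/-- The length of an interval (all intervals below have `b < e`). -/
def Slot.length (I : Slot) : ℕ := I.e - I.b

/-- The interval of `S_∞(t)` at position `i` (counting from `0`). -/
def slotAt (t i : ℕ) : Slot := ⟨t + gam i, t + gam (i + 1)⟩

/-- The intervals of `S_∞(t)`. -/
def infSlots (t : ℕ) : Set Slot := Set.range (slotAt t)

/-- The interval sequence `S_k(t)`, recorded by `k` and `t`. -/
structure Block where
  k : ℕ
  t : ℕ

/-- The intervals of `S_k(t)`: the first `n_k = 2^(k+1) - 1` intervals of `S_∞(t)`. -/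
def Block.slots (B : Block) : Set Slot := {I | ∃ i < (seqS B.k).length, I = slotAt B.t i}

/-- The start `b(S_k(t))`. -/
def Block.b (B : Block) : ℕ := B.t

/-- The end `e(S_k(t))`. -/
def Block.e (B : Block) : ℕ := B.t + gam (seqS B.k).length

/-! ### States, menus, updates -/

/-- A state `⟨A_1, …, A_ℓ⟩`. The list is kept in reverse order: its head is the last sequence
`A_ℓ`, that is, the tentative sequence. -/
abbrev State := List Block

/-- All the intervals of a state. -/
def State.slots (A : State) : Set Slot := {I | ∃ B ∈ A, I ∈ B.slots}

/-- The intervals of `τ(A, t)`: this is `A_1 ‖ … ‖ A_ℓ ‖ S_∞(t)` if `t ≥ e(A_ℓ)`, and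
`A_1 ‖ … ‖ A_{ℓ-1} ‖ S_∞(b(A_ℓ))` otherwise; it is `S_∞(t)` for the empty state. The intervals
occur in the sequence in the order of their starting times, so the set determines it. -/
def tau : State → ℕ → Set Slot
  | [], t => infSlots t
  | B :: A, t =>
      if B.e ≤ t then State.slots (B :: A) ∪ infSlots t else State.slots A ∪ infSlots B.b

/-- A configuration: the state, and the set of occupied (interval, machine) pairs. -/
structure Config (m : ℕ) where
  state : State
  occupied : Set (Slot × Fin m)

/-- The unoccupied (interval, machine) pairs of `τ(A, t)` that start no earlier than `t`. -/
def Config.available {m : ℕ} (ψ : Config m) (t : ℕ) : Set (Slot × Fin m) :=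
  {x | x.1 ∈ tau ψ.state t ∧ t ≤ x.1.b ∧ x ∉ ψ.occupied}

/-- The menu at time `t`. Going through the sequence `τ(A, t)` from time `t` on, one lists
the first interval that is unoccupied on some machine, then the first longer one,
then the first one longer than that, and so on, each of them on every machine on which
it is unoccupied. So an available pair is listed exactly if its interval is longer than every
available interval that starts earlier. -/
def Config.menu {m : ℕ} (ψ : Config m) (t : ℕ) : Set (Slot × Fin m) :=
  {x | x ∈ ψ.available t ∧ ∀ y ∈ ψ.available t, y.1.b < x.1.b → y.1.length < x.1.length}

open Classical in
/-- The cost to a job of processing time `p` of a menu entry with interval `I`: `b + p` if the job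
fits into `I`, and `∞` otherwise. -/
def jobCost (p : ℕ) (I : Slot) : ℕ∞ := if p ≤ I.length then ((I.b + p : ℕ) : ℕ∞) else ⊤

/-- A selfish job of processing time `p` takes some entry of the menu of least cost
(ties are broken arbitrarily). -/
def IsSelfishChoice {m : ℕ} (menu : Set (Slot × Fin m)) (p : ℕ) (x : Slot × Fin m) : Prop :=
  x ∈ menu ∧ ∀ y ∈ menu, jobCost p x.1 ≤ jobCost p y.1

open Classical in
/-- The new state after a job that arrived at time `t` chose the interval `I`. With `A_ℓ = S_d(t')`
the tentative sequence and `2^k` the length of `I`: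
(1) unchanged if `I` ends by `e(A_ℓ)`; otherwise
(2) append `S_k(t)` if `t ≥ e(A_ℓ)`;
(3) append `S_k(e(A_ℓ))` if `t < e(A_ℓ)` and `k ≤ d`;
(4) replace `A_ℓ` by `S_k(b(A_ℓ))` if `t < e(A_ℓ)` and `k > d`.
For the empty state, `e(A_ℓ) = 0`. -/
def updateState : State → ℕ → Slot → State
  | [], t, I => [⟨Nat.log 2 I.length, t⟩]
  | B :: A, t, I =>
      if I.e ≤ B.e then B :: A
      else if B.e ≤ t then ⟨Nat.log 2 I.length, t⟩ :: B :: A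
      else if Nat.log 2 I.length ≤ B.k then ⟨Nat.log 2 I.length, B.e⟩ :: B :: A
      else ⟨Nat.log 2 I.length, B.b⟩ :: A

/-- The new configuration after a job that arrived at time `t` chose `x`. -/
def Config.next {m : ℕ} (ψ : Config m) (t : ℕ) (x : Slot × Fin m) : Config m :=
  ⟨updateState ψ.state t x.1, insert x ψ.occupied⟩

/-- The time at which job `j` is served its menu. As all intervals have integer endpoints,
this is the first integer time at which the job is present. -/
def Input.arrival {n : ℕ} (σ : Input n) (j : Fin n) : ℕ := ⌈σ.r j⌉₊

/-- The configuration after the first `j` jobs have made their choices; it starts from the empty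
configuration. -/
def configAfter {m n : ℕ} (σ : Input n) (choice : Fin n → Slot × Fin m) : ℕ → Config m
  | 0 => ⟨[], ∅⟩
  | j + 1 =>
      if h : j < n then (configAfter σ choice j).next (σ.arrival ⟨j, h⟩) (choice ⟨j, h⟩)
      else configAfter σ choice j

/-- `choice` records the choices of the jobs in a run of the dynamic menu mechanism on `m` machines:
each job, in order, makes a selfish choice from the menu computed from its arrival time and
from the choices of the jobs before it. -/
def IsRun {m n : ℕ} (σ : Input n) (choice : Fin n → Slot × Fin m) : Prop :=
  ∀ j : Fin n,
    IsSelfishChoice ((configAfter σ choice j).menu (σ.arrival j)) (σ.p j) (choice j)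

/-- The completion time `c_j` of job `j`: it starts at the beginning of its interval. -/
def completion {m n : ℕ} (σ : Input n) (choice : Fin n → Slot × Fin m) (j : Fin n) : ℕ :=
  (choice j).1.b + σ.p j

/-! ### Preemptive schedules -/

/-- The amount of time that job `j` is processed up to time `t`, if `run q x` is the job (if any)
that machine `q` processes at time `x`. -/
def processedBy {m n : ℕ} (run : Fin m → ℝ → Option (Fin n)) (j : Fin n) (t : ℝ) : ℝ≥0∞ :=
  MeasureTheory.volume {x : ℝ | x ≤ t ∧ ∃ q, run q x = some j}

/-- A feasible preemptive schedule on `m` machines: at any time each machine processes at most one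
job, a job is processed only after its release and by at most one machine at a time (jobs may be
interrupted and may migrate), and every job is eventually fully processed. -/
structure PreemptiveSchedule (m : ℕ) {n : ℕ} (σ : Input n) where
  run : Fin m → ℝ → Option (Fin n)
  measurable : ∀ q j, MeasurableSet {x : ℝ | run q x = some j}
  released : ∀ q x j, run q x = some j → σ.r j ≤ x
  noParallel : ∀ q q' x j, run q x = some j → run q' x = some j → q = q'
  finishes : ∀ j, ∃ t : ℝ, (σ.p j : ℝ≥0∞) ≤ processedBy run j t

/-- The completion time of job `j`: the first time by which it has been processed for `p_j` units of
time. -/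
def PreemptiveSchedule.completion {m n : ℕ} {σ : Input n} (S : PreemptiveSchedule m σ)
    (j : Fin n) : ℝ :=
  sInf {t : ℝ | (σ.p j : ℝ≥0∞) ≤ processedBy S.run j t}

/-! ### Shortest remaining processing time, for integral release times

With integral data the rule changes its decisions only at integer times, so the schedule is
described by what happens during the unit steps `[t, t + 1]`. -/

/-- With remaining processing times `rem` at time `t`, job `i` is present and unfinished. -/
def IsPending {n : ℕ} (σ : Input n) (rem : Fin n → ℕ) (t : ℕ) (i : Fin n) : Prop :=
  σ.r i ≤ (t : ℝ) ∧ 0 < rem i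

open Classical in
/-- SRPT processes job `j` during `[t, t + 1]`: it is pending, and fewer than `m` pending jobs have
priority over it, where priority goes to the smaller remaining processing time and, among equal
ones, to the job that comes first in the input. -/
def SrptRuns (m : ℕ) {n : ℕ} (σ : Input n) (rem : Fin n → ℕ) (t : ℕ) (j : Fin n) : Prop :=
  IsPending σ rem t j ∧
    (Finset.univ.filter fun i : Fin n =>
      IsPending σ rem t i ∧ (rem i < rem j ∨ (rem i = rem j ∧ i < j))).card < m

open Classical in
/-- The remaining processing times at time `t` under SRPT on `m` machines. -/
def srptRemaining (m : ℕ) {n : ℕ} (σ : Input n) : ℕ → Fin n → ℕ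
  | 0 => σ.p
  | t + 1 => fun j =>
      if SrptRuns m σ (srptRemaining m σ t) t j then srptRemaining m σ t j - 1
      else srptRemaining m σ t j

/-- The completion time `c*_j` of job `j` under SRPT on `m` machines. -/
def srptCompletion (m : ℕ) {n : ℕ} (σ : Input n) (j : Fin n) : ℕ :=
  sInf {t : ℕ | srptRemaining m σ t j = 0}

end PromptScheduling

end

open PromptScheduling

/-! The sequence `S_h(u)` is read as a binary tree: an interval of length `2 ^ h` is the root of a
copy of `S_h`, and the two copies of `S_{h-1}` before it are its subtrees (`tree`). So `S_h` has
length `(h + 1) 2 ^ h`, of which the intervals of each length `2 ^ k` with `k ≤ h` make up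
`2 ^ h`. The size class of a job is the least `k` with `p ≤ 2 ^ k`.

*The mechanism.* A selfish job of class `k` arriving at `t` takes an interval before which all
the intervals of length at least `2 ^ k` that start at `t` or later are occupied on every
machine. Hence (`Inv`) within its sequence `A_i` no job skipped an interval it could have used; a
sequence only starts at the arrival time of a job or right after another sequence, whose last
interval the job found occupied if it could still have used it; and no sequence has order larger
than the largest size class `L`.

*Volume.* If all the intervals of length `2 ^ k` of a copy of `S_h` are occupied on a machine,
the jobs of class at most `k` placed there have rounded volume at least `2 ^ h`
(`Inv.two_pow_le_vol`): either the root is used by a job of class `h`, or it is used by a smaller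
job, which found all the intervals of its own class below the root occupied, and induction
applies to both subtrees. So time exceeds volume by a factor of at most `L + 1`. A copy of `S_h`
that is under way at the arrival of the job is cheap: either its first half is over, so that its
length is within a constant factor of the time that has passed, or its second half lies entirely
in the future. Adding up over the consecutive sequences of the state gives `c_j = O(L + 1) (t_j +
2 ^ k_j + V_j / m)`, where `V_j` is the rounded volume of the jobs up to `j` of class at most
`k_j` (`IsRun.mul_completion_le`).

*Comparison with SRPT.* With powers of two, SRPT never lets a job `i ≤ j` with `p_i ≤ p_j` fall
behind `j`, so that all of `V_j` is processed by time `c*_j`; and `c*_j ≥ r_j + p_j`.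

*Comparison with preemptive schedules.* By time `C_j` all the jobs `i` with `C_i ≤ C_j` have been
processed, so `m C_j ≥ ∑_{C_i ≤ C_j} p_i`. Of any two jobs one is completed by the time the other
one is, so summing over `j` bounds `∑_{i, j} min (p_i, p_j)`, and thereby `∑_j V_j`, by a
multiple of `m ∑ C_j` (`PreemptiveSchedule.sum_sum_min_le`). -/

noncomputable section

namespace PromptScheduling

/-! ### The intervals of `S_k(u)` as the nodes of a binary tree -/

/-- The total length `(h + 1) 2^h` of `S_h`. -/
def treeLen (h : ℕ) : ℕ := (h + 1) * 2 ^ h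

/-- The last interval of `S_h(u)`; it has length `2^h`. -/
def root (h u : ℕ) : Slot := ⟨u + h * 2 ^ h, u + treeLen h⟩

/-- The intervals of `S_h(u)`, by the recursion `S_{h+1} = S_h ‖ S_h ‖ ⟨2^(h+1)⟩`. In the binary
tree that this recursion describes, an interval of length `2^h` is the root of a copy of `S_h`, and
the two copies of `S_{h-1}` immediately before it are the subtrees of its children. -/
def tree : ℕ → ℕ → Set Slot
  | 0, u => {root 0 u}
  | h + 1, u => tree h u ∪ tree h (u + treeLen h) ∪ {root (h + 1) u}

lemma treeLen_succ (h : ℕ) : treeLen (h + 1) = treeLen h + treeLen h + 2 ^ (h + 1) := by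
  simp only [treeLen, pow_succ]; ring

lemma treeLen_add_self_le (h : ℕ) : treeLen h + treeLen h ≤ treeLen (h + 1) := by
  rw [treeLen_succ]; exact Nat.le_add_right _ _

lemma root_succ_b (h u : ℕ) : (root (h + 1) u).b = u + treeLen h + treeLen h := by
  simp only [root, treeLen, pow_succ]; ring

lemma root_e (h u : ℕ) : (root h u).e = u + treeLen h := rfl

lemma root_b_add (h u : ℕ) : (root h u).b + 2 ^ h = u + treeLen h := by
  simp only [root, treeLen]; ring

lemma root_length (h u : ℕ) : (root h u).length = 2 ^ h := by
  have h1 := root_b_add h u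
  have h2 := root_e h u
  rw [Slot.length, h2, ← h1, Nat.add_sub_cancel_left]

lemma le_root_b (h u : ℕ) : u ≤ (root h u).b := by simp [root]

lemma root_b_lt (h u : ℕ) : (root h u).b < u + treeLen h := by
  have h1 := root_b_add h u
  have : 0 < 2 ^ h := by positivity
  omega

lemma treeLen_mono : Monotone treeLen :=
  monotone_nat_of_le_succ fun h => by have := treeLen_add_self_le h; omega

lemma root_mem_tree (h u : ℕ) : root h u ∈ tree h u := by
  cases h <;> simp [tree]

lemma mem_tree_succ {h u : ℕ} {I : Slot} :
    I ∈ tree (h + 1) u ↔ I ∈ tree h u ∨ I ∈ tree h (u + treeLen h) ∨ I = root (h + 1) u := by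
  simp only [tree, Set.mem_union, Set.mem_singleton_iff, or_assoc]

lemma bounds_of_mem_tree {h u : ℕ} {I : Slot} (hI : I ∈ tree h u) :
    u ≤ I.b ∧ I.b < I.e ∧ I.e ≤ u + treeLen h := by
  induction h generalizing u with
  | zero =>
    obtain rfl : I = root 0 u := hI
    simp [root, treeLen]
  | succ h ih =>
    have h1 := treeLen_add_self_le h
    rcases mem_tree_succ.1 hI with hI | hI | rfl
    · have := ih hI; omega
    · have := ih hI; omega
    · have h2 := le_root_b (h + 1) u
      have h3 := root_b_lt (h + 1) u
      have h4 := root_e (h + 1) u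
      omega

lemma length_of_mem_tree {h u : ℕ} {I : Slot} (hI : I ∈ tree h u) :
    ∃ a ≤ h, I.length = 2 ^ a := by
  induction h generalizing u with
  | zero =>
    obtain rfl : I = root 0 u := hI
    exact ⟨0, le_rfl, root_length 0 u⟩
  | succ h ih =>
    rcases mem_tree_succ.1 hI with hI | hI | rfl
    · obtain ⟨a, ha, h1⟩ := ih hI; exact ⟨a, by omega, h1⟩
    · obtain ⟨a, ha, h1⟩ := ih hI; exact ⟨a, by omega, h1⟩
    · exact ⟨h + 1, le_rfl, root_length _ u⟩

lemma le_of_mem_tree {h u k : ℕ} {I : Slot} (hI : I ∈ tree h u) (hk : 2 ^ k ≤ I.length) :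
    k ≤ h := by
  obtain ⟨a, ha, h1⟩ := length_of_mem_tree hI
  rw [h1] at hk
  exact ((Nat.pow_le_pow_iff_right (by norm_num)).1 hk).trans ha

lemma eq_root_of_mem_tree {h u : ℕ} {I : Slot} (hI : I ∈ tree h u) (hl : 2 ^ h ≤ I.length) :
    I = root h u := by
  cases h with
  | zero => exact hI
  | succ h =>
    rcases mem_tree_succ.1 hI with hI | hI | rfl
    · have := le_of_mem_tree hI hl; omega
    · have := le_of_mem_tree hI hl; omega
    · rfl

lemma tree_mono (u : ℕ) : Monotone fun h => tree h u :=
  monotone_nat_of_le_succ fun _ _ hI => mem_tree_succ.2 (Or.inl hI)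

/-- `S_h` is an initial segment of `S_K` for `h ≤ K`. -/
lemma mem_tree_of_b_lt {h K u : ℕ} {I : Slot} (hI : I ∈ tree K u) (hb : I.b < u + treeLen h) :
    I ∈ tree h u := by
  rcases le_total K h with hK | hK
  · exact tree_mono u hK hI
  induction K with
  | zero => obtain rfl : h = 0 := by omega
            exact hI
  | succ K ih =>
    rcases hK.eq_or_lt with rfl | hlt
    · exact hI
    have hm := treeLen_mono (Nat.lt_succ_iff.1 hlt)
    rcases mem_tree_succ.1 hI with hI | hI | rfl
    · exact ih hI (by omega)
    · have := (bounds_of_mem_tree hI).1; omega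
    · rw [root_succ_b] at hb; omega

lemma length_seqS (k : ℕ) : (seqS k).length + 1 = 2 ^ (k + 1) := by
  induction k with
  | zero => rfl
  | succ k ih => simp only [seqS, List.length_append, List.length_singleton]; rw [pow_succ]; omega

lemma lt_length_seqS (i : ℕ) : i < (seqS i).length := by
  have h1 := length_seqS i
  have h2 : i + 1 < 2 ^ (i + 1) := Nat.lt_two_pow_self
  omega

lemma getD_seqS_of_le {k K i : ℕ} (h : k ≤ K) (hi : i < (seqS k).length) :
    (seqS K).getD i 0 = (seqS k).getD i 0 := by
  induction K, h using Nat.le_induction with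
  | base => rfl
  | succ K hK ih =>
    rw [← ih]
    have h1 := length_seqS k
    have h2 := length_seqS K
    have h3 : 2 ^ (k + 1) ≤ 2 ^ (K + 1) := Nat.pow_le_pow_right (by norm_num) (by omega)
    rw [seqS, List.append_assoc, List.getD_append _ _ _ _ (by omega)]

lemma seqInf_eq {k i : ℕ} (hi : i < (seqS k).length) : seqInf i = (seqS k).getD i 0 := by
  unfold seqInf
  rw [← getD_seqS_of_le (le_max_left k i) hi, ← getD_seqS_of_le (le_max_right k i)
    (lt_length_seqS i)]

lemma seqInf_length_add {k i : ℕ} (hi : i < (seqS k).length) :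
    seqInf ((seqS k).length + i) = seqInf i := by
  rw [seqInf_eq (k := k + 1) (by simp only [seqS, List.length_append]; omega), seqInf_eq hi, seqS,
    List.getD_append _ _ _ _ (by simp only [List.length_append]; omega),
    List.getD_append_right _ _ _ _ (by omega), Nat.add_sub_cancel_left]

lemma seqInf_two_mul_length (k : ℕ) :
    seqInf ((seqS k).length + (seqS k).length) = 2 ^ (k + 1) := by
  rw [seqInf_eq (k := k + 1) (by simp [seqS]), seqS,
    List.getD_append_right _ _ _ _ (by simp)]
  simp

lemma gam_succ (i : ℕ) : gam (i + 1) = gam i + seqInf i := Finset.sum_range_succ _ _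

lemma gam_length_add_aux {k i : ℕ} (hi : i ≤ (seqS k).length) :
    gam ((seqS k).length + i) = gam (seqS k).length + gam i := by
  induction i with
  | zero => simp [gam]
  | succ i ih =>
    rw [← add_assoc, gam_succ, gam_succ, ih (by omega), seqInf_length_add hi, add_assoc]

lemma gam_length (k : ℕ) : gam (seqS k).length = treeLen k := by
  induction k with
  | zero => simp [gam, seqS, seqInf, treeLen]
  | succ k ih =>
    simp only [seqS, List.length_append, List.length_singleton]
    rw [gam_succ, gam_length_add_aux le_rfl, ih, seqInf_two_mul_length, treeLen_succ]

lemma Block.e_eq (B : Block) : B.e = B.t + treeLen B.k := by rw [Block.e, gam_length]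

lemma Block.slots_eq (B : Block) : B.slots = tree B.k B.t := by
  obtain ⟨k, t⟩ := B
  simp only [Block.slots]
  induction k generalizing t with
  | zero =>
    ext I
    simp [seqS, tree, root, treeLen, slotAt, gam, seqInf]
  | succ k ih =>
    ext I
    have hg := gam_length k
    rw [mem_tree_succ, ← ih t, ← ih (t + treeLen k)]
    simp only [Set.mem_ofPred_eq]
    have hshift : ∀ i < (seqS k).length,
        slotAt t ((seqS k).length + i) = slotAt (t + treeLen k) i := by
      intro i hi
      simp only [slotAt]
      rw [add_assoc _ i, gam_length_add_aux hi.le, gam_length_add_aux (Nat.succ_le_of_lt hi), hg]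
      simp only [add_assoc]
    have hroot : slotAt t ((seqS k).length + (seqS k).length) = root (k + 1) t := by
      simp only [slotAt]
      rw [gam_succ, gam_length_add_aux le_rfl, seqInf_two_mul_length, hg]
      have h1 := root_succ_b k t
      have h2 := root_e (k + 1) t
      have h3 := treeLen_succ k
      generalize hr : root (k + 1) t = r at *
      obtain ⟨b, e⟩ := r
      simp only at h1 h2
      simp only [Slot.mk.injEq]; omega
    have hl : (seqS (k + 1)).length = (seqS k).length + (seqS k).length + 1 := by
      simp [seqS, add_assoc]
    constructor
    · rintro ⟨i, hi, rfl⟩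
      rcases lt_or_ge i (seqS k).length with h1 | h1
      · exact Or.inl ⟨i, h1, rfl⟩
      obtain ⟨i, rfl⟩ := Nat.exists_eq_add_of_le h1
      rcases lt_or_ge i (seqS k).length with h2 | h2
      · exact Or.inr (Or.inl ⟨i, h2, hshift i h2⟩)
      · obtain rfl : i = (seqS k).length := by omega
        exact Or.inr (Or.inr hroot)
    · rintro (⟨i, hi, rfl⟩ | ⟨i, hi, rfl⟩ | rfl)
      · exact ⟨i, by omega, rfl⟩
      · exact ⟨_, by omega, (hshift i hi).symm⟩
      · exact ⟨_, by omega, hroot.symm⟩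

lemma mem_infSlots {t : ℕ} {I : Slot} : I ∈ infSlots t ↔ ∃ k, I ∈ tree k t := by
  constructor
  · rintro ⟨i, rfl⟩
    refine ⟨i, ?_⟩
    rw [← Block.slots_eq ⟨i, t⟩]
    exact ⟨i, lt_length_seqS i, rfl⟩
  · rintro ⟨k, hk⟩
    rw [← Block.slots_eq ⟨k, t⟩] at hk
    obtain ⟨i, -, rfl⟩ := hk
    exact ⟨i, rfl⟩

lemma mem_tree_of_mem_infSlots {h u : ℕ} {I : Slot} (hI : I ∈ infSlots u)
    (hb : I.b < u + treeLen h) : I ∈ tree h u := by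
  obtain ⟨K, hK⟩ := mem_infSlots.1 hI
  exact mem_tree_of_b_lt hK hb

/-- The first interval of `S_∞(u)` of length at least `2^h` is the last one of `S_h(u)`. -/
lemma eq_root_of_mem_infSlots {h u : ℕ} {I : Slot} (hI : I ∈ infSlots u)
    (hl : 2 ^ h ≤ I.length) (hb : I.b ≤ (root h u).b) : I = root h u :=
  eq_root_of_mem_tree (mem_tree_of_mem_infSlots hI (hb.trans_lt (root_b_lt h u))) hl

/-- After the initial `S_d`, the sequence `S_∞` goes on with another copy of `S_d`, so that
the next interval of length at least `2^h`, for `h ≤ d`, is the last one of `S_h`. -/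
lemma eq_root_of_mem_infSlots_of_le {h d u : ℕ} {I : Slot} (hI : I ∈ infSlots u) (hd : h ≤ d)
    (hl : 2 ^ h ≤ I.length) (hb : u + treeLen d ≤ I.b) (hb' : I.b ≤ (root h (u + treeLen d)).b) :
    I = root h (u + treeLen d) := by
  have h1 := root_b_lt h (u + treeLen d)
  have h2 := treeLen_mono hd
  have h3 := treeLen_add_self_le d
  have hI' : I ∈ tree (d + 1) u := mem_tree_of_mem_infSlots hI (by omega)
  rcases mem_tree_succ.1 hI' with hI' | hI' | rfl
  · have := bounds_of_mem_tree hI'; omega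
  · exact eq_root_of_mem_tree (mem_tree_of_b_lt hI' (by omega)) hl
  · rw [root_succ_b] at hb'; omega

lemma tree_subset_infSlots_of_le {h d u : ℕ} (hd : h ≤ d) :
    tree h (u + treeLen d) ⊆ infSlots u := fun _ hI =>
  mem_infSlots.2 ⟨d + 1, mem_tree_succ.2 (Or.inr (Or.inl (tree_mono _ hd hI)))⟩

lemma tree_subset_infSlots (h u : ℕ) : tree h u ⊆ infSlots u := fun _ hI => mem_infSlots.2 ⟨h, hI⟩

/-! ### Selfish choices -/

lemma State.mem_slots {A : State} {I : Slot} : I ∈ State.slots A ↔ ∃ B ∈ A, I ∈ tree B.k B.t := by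
  simp only [State.slots, Set.mem_ofPred_eq, Block.slots_eq]

lemma exists_infSlots_subset_tau (A : State) (t : ℕ) : ∃ u, infSlots u ⊆ tau A t := by
  cases A with
  | nil => exact ⟨t, le_rfl⟩
  | cons B A =>
    by_cases h : B.e ≤ t
    · exact ⟨t, by rw [tau, if_pos h]; exact Set.subset_union_right⟩
    · exact ⟨B.b, by rw [tau, if_neg h]; exact Set.subset_union_right⟩

lemma length_of_mem_tau {A : State} {t : ℕ} {I : Slot} (hI : I ∈ tau A t) :
    ∃ a, I.length = 2 ^ a := by
  have h1 : ∀ {A : State}, I ∈ State.slots A → ∃ a, I.length = 2 ^ a := by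
    intro A h
    obtain ⟨B, -, hB⟩ := State.mem_slots.1 h
    obtain ⟨a, -, ha⟩ := length_of_mem_tree hB
    exact ⟨a, ha⟩
  have h2 : ∀ {u}, I ∈ infSlots u → ∃ a, I.length = 2 ^ a := by
    intro u h
    obtain ⟨k, hk⟩ := mem_infSlots.1 h
    obtain ⟨a, -, ha⟩ := length_of_mem_tree hk
    exact ⟨a, ha⟩
  cases A with
  | nil => exact h2 hI
  | cons B A =>
    rw [tau] at hI
    split_ifs at hI <;> exact hI.elim h1 h2

/-- A bounded set of occupied intervals leaves room for every job. -/
lemma exists_available {m : ℕ} (hm : 1 ≤ m) (ψ : Config m) (t p N : ℕ)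
    (hN : ∀ x ∈ ψ.occupied, x.1.b < N) : ∃ y ∈ ψ.available t, p ≤ y.1.length := by
  obtain ⟨u, hu⟩ := exists_infSlots_subset_tau ψ.state t
  obtain ⟨K, hNK, htK, hpK⟩ : ∃ K, N ≤ K ∧ t ≤ K ∧ p ≤ K :=
    ⟨N + t + p, by omega, by omega, by omega⟩
  have hK : K ≤ (root K u).b := by
    have : K * 1 ≤ K * 2 ^ K := Nat.mul_le_mul_left _ Nat.one_le_two_pow
    simp only [root]; omega
  refine ⟨(root K u, ⟨0, hm⟩), ⟨hu (tree_subset_infSlots K u (root_mem_tree K u)),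
    htK.trans hK, fun h => ?_⟩, ?_⟩
  · have := hN _ h
    simp only at this; omega
  · rw [root_length]; exact hpK.trans Nat.lt_two_pow_self.le

/-- The first available interval that is long enough is on the menu. -/
lemma exists_mem_menu_first {m : ℕ} {ψ : Config m} {t p : ℕ}
    (h : ∃ y ∈ ψ.available t, p ≤ y.1.length) :
    ∃ y ∈ ψ.menu t, p ≤ y.1.length ∧
      ∀ z ∈ ψ.available t, p ≤ z.1.length → y.1.b ≤ z.1.b := by
  classical
  have hex : ∃ b, ∃ y ∈ ψ.available t, p ≤ y.1.length ∧ y.1.b = b := by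
    obtain ⟨y, hy, hp⟩ := h; exact ⟨_, y, hy, hp, rfl⟩
  obtain ⟨y, hy, hp, hb⟩ := Nat.find_spec hex
  have hmin : ∀ z ∈ ψ.available t, p ≤ z.1.length → y.1.b ≤ z.1.b := fun z hz hpz =>
    hb ▸ Nat.find_min' hex ⟨z, hz, hpz, rfl⟩
  refine ⟨y, ⟨hy, fun z hz hzb => ?_⟩, hp, hmin⟩
  by_contra! hlen
  have := hmin z hz (hp.trans hlen)
  omega

lemma exists_isSelfishChoice {m : ℕ} {ψ : Config m} {t p : ℕ}
    (h : ∃ y ∈ ψ.available t, p ≤ y.1.length) : ∃ x, IsSelfishChoice (ψ.menu t) p x := by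
  obtain ⟨y, hy, hp, hmin⟩ := exists_mem_menu_first h
  refine ⟨y, hy, fun z hz => ?_⟩
  simp only [jobCost, if_pos hp]
  split_ifs with hpz
  · have := hmin z hz.1 hpz
    exact_mod_cast Nat.add_le_add_right this p
  · exact le_top

/-- A selfish job takes an interval into which it fits, and no available interval into which it
fits starts earlier. -/
lemma IsSelfishChoice.spec {m : ℕ} {ψ : Config m} {t p : ℕ} {x : Slot × Fin m}
    (hx : IsSelfishChoice (ψ.menu t) p x) (h : ∃ y ∈ ψ.available t, p ≤ y.1.length) :
    p ≤ x.1.length ∧ ∀ z ∈ ψ.available t, p ≤ z.1.length → x.1.b ≤ z.1.b := by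
  obtain ⟨y, hy, hp, hmin⟩ := exists_mem_menu_first h
  have hc := hx.2 y hy
  simp only [jobCost, if_pos hp] at hc
  split_ifs at hc with hpx
  · refine ⟨hpx, fun z hz hpz => le_trans ?_ (hmin z hz hpz)⟩
    have : x.1.b + p ≤ y.1.b + p := by exact_mod_cast hc
    omega
  · exact absurd hc (by simp)

/-! ### The invariant of the mechanism -/

/-- The first `s` jobs occupy the interval `I` on machine `q`. -/
def Occ {m n : ℕ} (x : Fin n → Slot × Fin m) (s : ℕ) (I : Slot) (q : Fin m) : Prop :=
  ∃ i : Fin n, i.1 < s ∧ x i = (I, q)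

lemma Occ.succ {m n : ℕ} {x : Fin n → Slot × Fin m} {s : ℕ} {I : Slot} {q : Fin m}
    (h : Occ x s I q) : Occ x (s + 1) I q := by
  obtain ⟨i, hi, h⟩ := h
  exact ⟨i, by omega, h⟩

/-- The sequences of a state follow each other in time. Each of them starts either by time `T`
or exactly at the end of its predecessor; in the second case, if the predecessor starts at `T` or
later, the last interval of the predecessor has the property `occ`. The head of the list is the
last sequence. -/
def Chained (occ : Slot → Prop) (T : ℕ) : State → Prop
  | [] => True
  | [B] => B.t ≤ T
  | B :: B' :: A =>
      B'.t + treeLen B'.k ≤ B.t ∧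
      (B.t ≤ T ∨ B.t = B'.t + treeLen B'.k ∧ (T ≤ B'.t → occ (root B'.k B'.t))) ∧
      Chained occ T (B' :: A)

lemma Chained.mono {occ occ' : Slot → Prop} (ho : ∀ I, occ I → occ' I) {T T' : ℕ} (hT : T ≤ T')
    {A : State} (h : Chained occ T A) : Chained occ' T' A := by
  induction A with
  | nil => trivial
  | cons B A ih =>
    cases A with
    | nil => exact le_trans (show B.t ≤ T from h) hT
    | cons B' A =>
      obtain ⟨h1, h2, h3⟩ := h
      refine ⟨h1, ?_, ih h3⟩
      rcases h2 with h2 | ⟨h2, h4⟩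
      · exact Or.inl (h2.trans hT)
      · exact Or.inr ⟨h2, fun h => ho _ (h4 (hT.trans h))⟩

lemma Chained.tail {occ : Slot → Prop} {T : ℕ} {B : Block} {A : State}
    (h : Chained occ T (B :: A)) : Chained occ T A := by
  cases A with
  | nil => trivial
  | cons B' A => exact h.2.2

lemma Chained.e_le {occ : Slot → Prop} {T : ℕ} {B : Block} {A : State}
    (h : Chained occ T (B :: A)) : ∀ B' ∈ A, B'.t + treeLen B'.k ≤ B.t := by
  induction A generalizing B with
  | nil => simp
  | cons B₁ A ih =>
    intro B' hB'
    rcases List.mem_cons.1 hB' with rfl | hB'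
    · exact h.1
    · have h1 := ih h.2.2 B' hB'
      have h2 := h.1
      omega

/-- Replacing the last sequence by another one with the same start keeps the chain intact. -/
lemma Chained.replace {occ : Slot → Prop} {T : ℕ} {B : Block} {A : State}
    (h : Chained occ T (B :: A)) (k : ℕ) : Chained occ T (⟨k, B.t⟩ :: A) := by
  cases A with
  | nil => exact h
  | cons B' A => exact h

lemma Chained.block_unique {occ : Slot → Prop} {T : ℕ} {A : State} (h : Chained occ T A)
    {B B' : Block} (hB : B ∈ A) (hB' : B' ∈ A) {I : Slot} (hI : I ∈ tree B.k B.t)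
    (hI' : I ∈ tree B'.k B'.t) : B = B' := by
  have h1 := bounds_of_mem_tree hI
  have h2 := bounds_of_mem_tree hI'
  induction A with
  | nil => simp at hB
  | cons B₀ A ih =>
    have he := h.e_le
    rcases List.mem_cons.1 hB with rfl | hBA <;> rcases List.mem_cons.1 hB' with rfl | hBA'
    · rfl
    · have := he _ hBA'; omega
    · have := he _ hBA; omega
    · exact ih h.tail hBA hBA'

/-- The invariant of the mechanism after the first `s` jobs, all of which arrived by time `T`. Job
`i` arrives at `a i`, has size class `c i` (it needs an interval of length `2 ^ c i`) and is placed
at `x i`. The field `placed` says that within the sequence that contains the interval of job `i`,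
all the earlier intervals which the job could have used are occupied on all machines. -/
structure Inv {m n : ℕ} (x : Fin n → Slot × Fin m) (a c : Fin n → ℕ) (L s : ℕ) (A : State)
    (T : ℕ) : Prop where
  chained : Chained (fun I => ∀ q, Occ x s I q) T A
  arrival_le : ∀ i : Fin n, i.1 < s → a i ≤ T
  fits : ∀ i : Fin n, i.1 < s → 2 ^ c i ≤ (x i).1.length
  placed : ∀ i : Fin n, i.1 < s → ∃ B ∈ A, (x i).1 ∈ tree B.k B.t ∧
    ∀ J ∈ tree B.k B.t, a i ≤ J.b → J.b < (x i).1.b → 2 ^ c i ≤ J.length → ∀ q, Occ x s J q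
  k_le : ∀ B ∈ A, B.k ≤ L

lemma Inv.occ_b_lt {m n : ℕ} {x : Fin n → Slot × Fin m} {a c : Fin n → ℕ} {L s : ℕ} {B : Block}
    {A : State} {T : ℕ} (h : Inv x a c L s (B :: A) T) {I : Slot} {q : Fin m} (ho : Occ x s I q) :
    I.b < B.t + treeLen B.k := by
  obtain ⟨i, hi, hx⟩ := ho
  obtain ⟨B', hB', hI, -⟩ := h.placed i hi
  rw [hx] at hI
  have h1 := bounds_of_mem_tree hI
  rcases List.mem_cons.1 hB' with rfl | hB'
  · exact h1.2.1.trans_le h1.2.2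
  · have := h.chained.e_le _ hB'
    simp only at h1; omega

lemma log_root_length (k u : ℕ) : Nat.log 2 (root k u).length = k := by
  rw [root_length, Nat.log_pow (by norm_num)]

/-- The possible effects of a choice on the state. A new or longer last sequence has the chosen
interval as its last one, and the length of that interval is exactly the size class of the job. -/
lemma updateState_cases {m n : ℕ} {x : Fin n → Slot × Fin m} {a c : Fin n → ℕ} {L s : ℕ}
    {B : Block} {A : State} {T t k : ℕ} {I : Slot} {q : Fin m} (h : Inv x a c L s (B :: A) T)
    (hI : I ∈ tau (B :: A) t) (hb : t ≤ I.b) (hk : 2 ^ k ≤ I.length)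
    (hmin : ∀ J ∈ tau (B :: A) t, t ≤ J.b → 2 ^ k ≤ J.length → ¬ Occ x s J q → I.b ≤ J.b) :
    (updateState (B :: A) t I = B :: A ∧ I ∈ State.slots (B :: A)) ∨
    (B.t + treeLen B.k ≤ t ∧ I = root k t ∧ updateState (B :: A) t I = ⟨k, t⟩ :: B :: A) ∨
    (t < B.t + treeLen B.k ∧ k ≤ B.k ∧ I = root k (B.t + treeLen B.k) ∧
      updateState (B :: A) t I = ⟨k, B.t + treeLen B.k⟩ :: B :: A) ∨
    (t < B.t + treeLen B.k ∧ B.k < k ∧ I = root k B.t ∧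
      updateState (B :: A) t I = ⟨k, B.t⟩ :: A) := by
  have hfree : ∀ J : Slot, B.t + treeLen B.k ≤ J.b → ¬ Occ x s J q := fun J hJ ho => by
    have := h.occ_b_lt ho; omega
  have hold : ∀ J ∈ State.slots A, J.b < J.e ∧ J.e ≤ B.t := fun J hJ => by
    obtain ⟨B', hB', hJ⟩ := State.mem_slots.1 hJ
    have h1 := bounds_of_mem_tree hJ
    have h2 := h.chained.e_le _ hB'
    omega
  simp only [tau, updateState, Block.e_eq, Block.b] at hI hmin ⊢
  by_cases hte : B.t + treeLen B.k ≤ t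
  · rw [if_pos hte] at hI hmin
    have hIt : I ∈ infSlots t := by
      refine hI.resolve_left fun hs => ?_
      obtain ⟨B', hB', hJ⟩ := State.mem_slots.1 hs
      have h1 := bounds_of_mem_tree hJ
      rcases List.mem_cons.1 hB' with rfl | hB'
      · omega
      · have := h.chained.e_le _ hB'; omega
    have hr := le_root_b k t
    have hIr : I = root k t := eq_root_of_mem_infSlots hIt hk <|
      hmin _ (Or.inr (tree_subset_infSlots k t (root_mem_tree k t))) hr (root_length k t).ge
        (hfree _ (hte.trans hr))
    have he : ¬ I.e ≤ B.t + treeLen B.k := by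
      have := root_b_lt k t
      rw [hIr, root_e]; omega
    refine Or.inr (Or.inl ⟨hte, hIr, ?_⟩)
    rw [if_neg he, if_pos hte, hIr, log_root_length]
  · rw [if_neg hte] at hI hmin
    by_cases he : I.e ≤ B.t + treeLen B.k
    · refine Or.inl ⟨if_pos he, State.mem_slots.2 ?_⟩
      rcases hI with hI | hI
      · obtain ⟨B', hB', hI⟩ := State.mem_slots.1 hI
        exact ⟨B', List.mem_cons_of_mem _ hB', hI⟩
      · obtain ⟨K, hK⟩ := mem_infSlots.1 hI
        have h1 := bounds_of_mem_tree hK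
        exact ⟨B, List.mem_cons_self, mem_tree_of_b_lt hK (by omega)⟩
    · have hIB : I ∈ infSlots B.t := hI.resolve_left fun hs => by
        have := hold _ hs; omega
      have hIb : B.t + treeLen B.k ≤ I.b := by
        by_contra! hlt
        have := bounds_of_mem_tree (mem_tree_of_mem_infSlots hIB hlt)
        omega
      by_cases hkd : k ≤ B.k
      · have hr := le_root_b k (B.t + treeLen B.k)
        have hIr : I = root k (B.t + treeLen B.k) :=
          eq_root_of_mem_infSlots_of_le hIB hkd hk hIb <|
            hmin _ (Or.inr (tree_subset_infSlots_of_le hkd (root_mem_tree _ _)))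
              (by omega) (root_length _ _).ge (hfree _ hr)
        refine Or.inr (Or.inr (Or.inl ⟨by omega, hkd, hIr, ?_⟩))
        rw [if_neg he, if_neg hte, hIr, log_root_length, if_pos hkd]
      · obtain ⟨k', rfl⟩ : ∃ k', k = k' + 1 := ⟨k - 1, by omega⟩
        have hr := root_succ_b k' B.t
        have hl := treeLen_mono (show B.k ≤ k' by omega)
        have hIr : I = root (k' + 1) B.t := eq_root_of_mem_infSlots hIB hk <|
          hmin _ (Or.inr (tree_subset_infSlots _ _ (root_mem_tree _ _)))
            (by omega) (root_length _ _).ge (hfree _ (by omega))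
        refine Or.inr (Or.inr (Or.inr ⟨by omega, by omega, hIr, ?_⟩))
        rw [if_neg he, if_neg hte, hIr, log_root_length, if_neg hkd]

lemma slots_subset_tau (A : State) (t : ℕ) : State.slots A ⊆ tau A t := by
  intro I hI
  cases A with
  | nil => simp [State.slots] at hI
  | cons B A =>
    simp only [tau]
    split_ifs with hte
    · exact Or.inl hI
    · obtain ⟨B', hB', hIB⟩ := State.mem_slots.1 hI
      rcases List.mem_cons.1 hB' with rfl | hB'
      · exact Or.inr (tree_subset_infSlots _ _ hIB)
      · exact Or.inl (State.mem_slots.2 ⟨B', hB', hIB⟩)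

lemma Inv.zero {m n : ℕ} (x : Fin n → Slot × Fin m) (a c : Fin n → ℕ) (L : ℕ) :
    Inv x a c L 0 [] 0 :=
  ⟨trivial, by simp, by simp, by simp, by simp⟩

/-- One step of the mechanism preserves the invariant; moreover all the intervals of the new state
were offered to the job by `τ`. -/
lemma Inv.succ {m n : ℕ} {x : Fin n → Slot × Fin m} {a c : Fin n → ℕ} {L s : ℕ} {A : State}
    {T : ℕ} (h : Inv x a c L s A T) (j : Fin n) (hj : j.1 = s) (hT : T ≤ a j) (hL : c j ≤ L)
    (hI : (x j).1 ∈ tau A (a j)) (hb : a j ≤ (x j).1.b) (hk : 2 ^ c j ≤ (x j).1.length)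
    (hmin : ∀ J ∈ tau A (a j), ∀ q, a j ≤ J.b → 2 ^ c j ≤ J.length → ¬ Occ x s J q →
      (x j).1.b ≤ J.b) :
    Inv x a c L (s + 1) (updateState A (a j) (x j).1) (a j) ∧
      State.slots (updateState A (a j) (x j).1) ⊆ tau A (a j) := by
  have key : ∀ A' : State, State.slots A' ⊆ tau A (a j) →
      Chained (fun I => ∀ q, Occ x s I q) (a j) A' →
      (∀ i : Fin n, i.1 < s → ∃ B ∈ A', (x i).1 ∈ tree B.k B.t ∧
        ∀ J ∈ tree B.k B.t, a i ≤ J.b → J.b < (x i).1.b → 2 ^ c i ≤ J.length →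
          ∀ q, Occ x s J q) →
      (∃ B ∈ A', (x j).1 ∈ tree B.k B.t) → (∀ B ∈ A', B.k ≤ L) →
      Inv x a c L (s + 1) A' (a j) ∧ State.slots A' ⊆ tau A (a j) := by
    intro A' hsub hch hold hnew hkL
    have hcases : ∀ i : Fin n, i.1 < s + 1 → i.1 < s ∨ i = j := fun i hi => by
      rcases Nat.lt_succ_iff_lt_or_eq.1 hi with hi | hi
      · exact Or.inl hi
      · exact Or.inr (Fin.ext (hi.trans hj.symm))
    refine ⟨⟨hch.mono (fun I hI q => (hI q).succ) le_rfl, ?_, ?_, ?_, hkL⟩, hsub⟩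
    · intro i hi
      rcases hcases i hi with hi | rfl
      · exact (h.arrival_le i hi).trans hT
      · exact le_rfl
    · intro i hi
      rcases hcases i hi with hi | rfl
      · exact h.fits i hi
      · exact hk
    · intro i hi
      rcases hcases i hi with hi | rfl
      · obtain ⟨B, hB, h1, h2⟩ := hold i hi
        exact ⟨B, hB, h1, fun J hJ h3 h4 h5 q => (h2 J hJ h3 h4 h5 q).succ⟩
      · obtain ⟨B, hB, h1⟩ := hnew
        refine ⟨B, hB, h1, fun J hJ h3 h4 h5 q => Occ.succ ?_⟩
        by_contra ho
        have := hmin J (hsub (State.mem_slots.2 ⟨B, hB, hJ⟩)) q h3 h5 ho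
        omega
  cases A with
  | nil =>
    have hs : ∀ i : Fin n, ¬ i.1 < s := fun i hi => by
      obtain ⟨B, hB, -⟩ := h.placed i hi
      simp at hB
    have hIr : (x j).1 = root (c j) (a j) := eq_root_of_mem_infSlots hI hk <|
      hmin _ (tree_subset_infSlots _ _ (root_mem_tree _ _)) (x j).2 (le_root_b _ _)
        (root_length _ _).ge fun ⟨i, hi, _⟩ => hs i hi
    have hu : updateState [] (a j) (x j).1 = [⟨c j, a j⟩] := by
      rw [updateState, hIr, log_root_length]
    rw [hu]
    refine key _ ?_ le_rfl (fun i hi => absurd hi (hs i)) ?_ (by simpa using hL)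
    · intro J hJ
      obtain ⟨B, hB, hJ⟩ := State.mem_slots.1 hJ
      obtain rfl := List.mem_singleton.1 hB
      exact tree_subset_infSlots _ _ hJ
    · exact ⟨_, List.mem_singleton_self _, hIr ▸ root_mem_tree _ _⟩
  | cons B A =>
    have hch := h.chained.mono (fun _ => id) hT
    have hsub := slots_subset_tau (B :: A) (a j)
    rcases updateState_cases h hI hb hk (fun J hJ => hmin J hJ (x j).2) with
      ⟨hu, hIs⟩ | ⟨hte, hIr, hu⟩ | ⟨hte, hkd, hIr, hu⟩ | ⟨hte, hkd, hIr, hu⟩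
    · rw [hu]
      exact key _ hsub hch h.placed (State.mem_slots.1 hIs) h.k_le
    · rw [hu]
      refine key _ ?_ ⟨hte, Or.inl le_rfl, hch⟩ ?_
        ⟨_, List.mem_cons_self, hIr ▸ root_mem_tree _ _⟩ (List.forall_mem_cons.2 ⟨hL, h.k_le⟩)
      · intro J hJ
        obtain ⟨B', hB', hJ⟩ := State.mem_slots.1 hJ
        rcases List.mem_cons.1 hB' with rfl | hB'
        · simp only [tau, Block.e_eq, if_pos hte]
          exact Or.inr (tree_subset_infSlots _ _ hJ)
        · exact hsub (State.mem_slots.2 ⟨B', hB', hJ⟩)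
      · intro i hi
        obtain ⟨B', hB', h1⟩ := h.placed i hi
        exact ⟨B', List.mem_cons_of_mem _ hB', h1⟩
    · have hnte : ¬ B.t + treeLen B.k ≤ a j := by omega
      rw [hu]
      refine key _ ?_ ⟨le_rfl, Or.inr ⟨rfl, fun hBt q => ?_⟩, hch⟩ ?_
        ⟨_, List.mem_cons_self, hIr ▸ root_mem_tree _ _⟩ (List.forall_mem_cons.2 ⟨hL, h.k_le⟩)
      · intro J hJ
        obtain ⟨B', hB', hJ⟩ := State.mem_slots.1 hJ
        rcases List.mem_cons.1 hB' with rfl | hB'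
        · simp only [tau, Block.e_eq, if_neg hnte]
          exact Or.inr (tree_subset_infSlots_of_le hkd hJ)
        · exact hsub (State.mem_slots.2 ⟨B', hB', hJ⟩)
      · -- the job would have preferred the last interval of the old last sequence
        by_contra ho
        have h1 := hmin (root B.k B.t)
          (hsub (State.mem_slots.2 ⟨B, List.mem_cons_self, root_mem_tree _ _⟩)) q
          (hBt.trans (le_root_b _ _))
          ((Nat.pow_le_pow_right (by norm_num) hkd).trans (root_length _ _).ge) ho
        have h2 := root_b_lt B.k B.t
        have h3 := le_root_b (c j) (B.t + treeLen B.k)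
        rw [hIr] at h1
        omega
      · intro i hi
        obtain ⟨B', hB', h1⟩ := h.placed i hi
        exact ⟨B', List.mem_cons_of_mem _ hB', h1⟩
    · have hnte : ¬ B.t + treeLen B.k ≤ a j := by omega
      rw [hu]
      refine key _ ?_ (hch.replace _) ?_
        ⟨_, List.mem_cons_self, hIr ▸ root_mem_tree _ _⟩ ?_
      · intro J hJ
        obtain ⟨B', hB', hJ⟩ := State.mem_slots.1 hJ
        rcases List.mem_cons.1 hB' with rfl | hB'
        · simp only [tau, Block.e_eq, if_neg hnte]
          exact Or.inr (tree_subset_infSlots _ _ hJ)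
        · exact hsub (State.mem_slots.2 ⟨B', List.mem_cons_of_mem _ hB', hJ⟩)
      · intro i hi
        obtain ⟨B', hB', h1, h2⟩ := h.placed i hi
        rcases List.mem_cons.1 hB' with rfl | hB'
        · refine ⟨_, List.mem_cons_self, tree_mono _ hkd.le h1, fun J hJ h3 h4 => ?_⟩
          have h5 := bounds_of_mem_tree h1
          exact h2 J (mem_tree_of_b_lt hJ (by omega)) h3 h4
        · exact ⟨B', List.mem_cons_of_mem _ hB', h1, h2⟩
      · intro B' hB'
        rcases List.mem_cons.1 hB' with rfl | hB'
        · exact hL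
        · exact h.k_le _ (List.mem_cons_of_mem _ hB')

/-! ### Runs -/

lemma occupied_configAfter {m n : ℕ} (σ : Input n) (x : Fin n → Slot × Fin m) (s : ℕ) :
    (configAfter σ x s).occupied = {y | Occ x s y.1 y.2} := by
  induction s with
  | zero => ext; simp [configAfter, Occ]
  | succ s ih =>
    ext y
    by_cases hs : s < n
    · simp only [configAfter, dif_pos hs, Config.next, ih, Set.mem_insert_iff, Set.mem_ofPred_eq,
        Occ]
      constructor
      · rintro (rfl | ⟨i, hi, h⟩)
        · exact ⟨⟨s, hs⟩, Nat.lt_succ_self s, rfl⟩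
        · exact ⟨i, by omega, h⟩
      · rintro ⟨i, hi, h⟩
        rcases Nat.lt_succ_iff_lt_or_eq.1 hi with hi | rfl
        · exact Or.inr ⟨i, hi, h⟩
        · exact Or.inl h.symm
    · simp only [configAfter, dif_neg hs, ih, Set.mem_ofPred_eq, Occ]
      constructor
      · rintro ⟨i, hi, h⟩; exact ⟨i, by omega, h⟩
      · rintro ⟨i, hi, h⟩; exact ⟨i, by omega, h⟩

/-- The size class of a job: the job fits into an interval of `S_∞` of length `2 ^ k` if and only
if its size class is at most `k`. -/
def Input.cls {n : ℕ} (σ : Input n) (j : Fin n) : ℕ := Nat.clog 2 (σ.p j)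

lemma Input.p_le {n : ℕ} (σ : Input n) (j : Fin n) : σ.p j ≤ 2 ^ σ.cls j :=
  Nat.le_pow_clog (by norm_num) _

lemma Input.arrival_mono {n : ℕ} (σ : Input n) : Monotone σ.arrival :=
  fun _ _ h => Nat.ceil_mono (σ.r_mono h)

lemma exists_available_configAfter {m n : ℕ} (hm : 1 ≤ m) (σ : Input n) (x : Fin n → Slot × Fin m)
    (s t p : ℕ) : ∃ y ∈ (configAfter σ x s).available t, p ≤ y.1.length := by
  refine exists_available hm _ t p (∑ i, (x i).1.b + 1) fun y hy => ?_
  rw [occupied_configAfter] at hy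
  obtain ⟨i, -, hi⟩ := hy
  have : (x i).1.b ≤ ∑ i, (x i).1.b :=
    Finset.single_le_sum (f := fun i => (x i).1.b) (fun _ _ => Nat.zero_le _) (Finset.mem_univ i)
  rw [hi] at this
  exact Nat.lt_succ_of_le this

/-- What a job of a run sees when it makes its choice. -/
lemma IsRun.step {m n : ℕ} (hm : 1 ≤ m) {σ : Input n} {x : Fin n → Slot × Fin m}
    (hx : IsRun σ x) (j : Fin n) :
    (x j).1 ∈ tau (configAfter σ x j).state (σ.arrival j) ∧ σ.arrival j ≤ (x j).1.b ∧
    2 ^ σ.cls j ≤ (x j).1.length ∧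
    ∀ J ∈ tau (configAfter σ x j).state (σ.arrival j), ∀ q, σ.arrival j ≤ J.b →
      2 ^ σ.cls j ≤ J.length → ¬ Occ x j J q → (x j).1.b ≤ J.b := by
  have hav := exists_available_configAfter hm σ x j (σ.arrival j) (σ.p j)
  obtain ⟨h1, h2⟩ := (hx j).spec hav
  obtain ⟨h3, h4, h5⟩ := (hx j).1.1
  refine ⟨h3, h4, ?_, fun J hJ q hJb hJl ho => ?_⟩
  · obtain ⟨k, hk⟩ := length_of_mem_tau h3
    rw [hk] at h1 ⊢
    exact Nat.pow_le_pow_right (by norm_num) (Nat.clog_le_of_le_pow h1)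
  · refine h2 (J, q) ⟨hJ, hJb, ?_⟩ ((σ.p_le j).trans hJl)
    rw [occupied_configAfter]
    exact ho

lemma IsRun.exists_inv {m n : ℕ} (hm : 1 ≤ m) {σ : Input n} {x : Fin n → Slot × Fin m}
    (hx : IsRun σ x) {L : ℕ} (hL : ∀ j, σ.cls j ≤ L) (s : ℕ) (hs : s ≤ n) :
    ∃ T, (∀ j : Fin n, s ≤ j.1 → T ≤ σ.arrival j) ∧
      Inv x σ.arrival σ.cls L s (configAfter σ x s).state T := by
  induction s with
  | zero => exact ⟨0, fun _ _ => Nat.zero_le _, Inv.zero _ _ _ _⟩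
  | succ s ih =>
    obtain ⟨T, hT, hinv⟩ := ih (by omega)
    obtain ⟨h1, h2, h3, h4⟩ := hx.step hm ⟨s, hs⟩
    refine ⟨σ.arrival ⟨s, hs⟩, fun j hj => σ.arrival_mono (Fin.le_def.2 (by simp; omega)), ?_⟩
    have hs' : s < n := hs
    simp only [configAfter, dif_pos hs', Config.next]
    exact (hinv.succ ⟨s, hs⟩ rfl (hT _ le_rfl) (hL _) h1 h2 h3 h4).1

/-- The configuration after job `j`: the invariant, and the fact that every earlier interval in
which job `j` would have fitted is occupied on all machines. -/
lemma IsRun.inv_after {m n : ℕ} (hm : 1 ≤ m) {σ : Input n} {x : Fin n → Slot × Fin m}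
    (hx : IsRun σ x) {L : ℕ} (hL : ∀ j, σ.cls j ≤ L) (j : Fin n) :
    ∃ A : State, Inv x σ.arrival σ.cls L (j + 1) A (σ.arrival j) ∧
      ∀ B ∈ A, ∀ J ∈ tree B.k B.t, σ.arrival j ≤ J.b → J.b < (x j).1.b →
        2 ^ σ.cls j ≤ J.length → ∀ q, Occ x (j + 1) J q := by
  obtain ⟨T, hT, hinv⟩ := hx.exists_inv hm hL j j.2.le
  obtain ⟨h1, h2, h3, h4⟩ := hx.step hm j
  obtain ⟨h5, h6⟩ := hinv.succ j rfl (hT _ le_rfl) (hL _) h1 h2 h3 h4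
  refine ⟨_, h5, fun B hB J hJ hJb hJx hJl q => Occ.succ ?_⟩
  by_contra ho
  have := h4 J (h6 (State.mem_slots.2 ⟨B, hB, hJ⟩)) q hJb hJl ho
  omega

/-- The mechanism has a run: the choices are constructed one job at a time. -/
lemma exists_isRun {m n : ℕ} (hm : 1 ≤ m) (σ : Input n) :
    ∃ x : Fin n → Slot × Fin m, IsRun σ x := by
  have hcongr : ∀ (x y : Fin n → Slot × Fin m) (s : ℕ), (∀ i : Fin n, i.1 < s → x i = y i) →
      configAfter σ x s = configAfter σ y s := by
    intro x y s h
    induction s with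
    | zero => rfl
    | succ s ih =>
      have := ih fun i hi => h i (by omega)
      by_cases hs : s < n
      · simp only [configAfter, dif_pos hs, this, h ⟨s, hs⟩ (Nat.lt_succ_self s)]
      · simp only [configAfter, dif_neg hs, this]
  have main : ∀ s ≤ n, ∃ x : Fin n → Slot × Fin m, ∀ j : Fin n, j.1 < s →
      IsSelfishChoice ((configAfter σ x j).menu (σ.arrival j)) (σ.p j) (x j) := by
    intro s hs
    induction s with
    | zero => exact ⟨fun _ => (⟨0, 0⟩, ⟨0, hm⟩), by simp⟩
    | succ s ih =>
      obtain ⟨x, hx⟩ := ih (by omega)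
      obtain ⟨y, hy⟩ := exists_isSelfishChoice
        (exists_available_configAfter hm σ x s (σ.arrival ⟨s, hs⟩) (σ.p ⟨s, hs⟩))
      have hne : ∀ i : Fin n, i.1 < s → Function.update x ⟨s, hs⟩ y i = x i := fun i hi =>
        Function.update_of_ne (fun h => by simp [h] at hi) _ _
      refine ⟨Function.update x ⟨s, hs⟩ y, fun j hj => ?_⟩
      rw [hcongr _ x j fun i hi => hne i (by omega)]
      rcases Nat.lt_succ_iff_lt_or_eq.1 hj with hj | hj
      · rw [hne j hj]; exact hx j hj
      · obtain rfl : j = ⟨s, hs⟩ := Fin.ext hj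
        rw [Function.update_self]; exact hy
  obtain ⟨x, hx⟩ := main n le_rfl
  exact ⟨x, fun j => hx j j.2⟩

/-! ### Occupied intervals account for processing volume -/

open Classical in
/-- The volume, rounded up to powers of two, of those among the first `s` jobs that are of size
class at most `k` and have an interval on machine `q` that starts in `[u, v)`. -/
def vol {m n : ℕ} (x : Fin n → Slot × Fin m) (c : Fin n → ℕ) (s : ℕ) (q : Fin m) (k u v : ℕ) : ℕ :=
  ∑ i with i.1 < s ∧ c i ≤ k ∧ (x i).2 = q ∧ u ≤ (x i).1.b ∧ (x i).1.b < v, 2 ^ c i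

section Volume

variable {m n : ℕ} {x : Fin n → Slot × Fin m} {a c : Fin n → ℕ} {L s : ℕ} {A : State} {T : ℕ}
  {q : Fin m}

lemma vol_mono {k k' u u' v v' : ℕ} (hk : k ≤ k') (hu : u' ≤ u) (hv : v ≤ v') :
    vol x c s q k u v ≤ vol x c s q k' u' v' := by
  refine Finset.sum_le_sum_of_subset fun i hi => ?_
  simp only [Finset.mem_filter, Finset.mem_univ, true_and] at hi ⊢
  obtain ⟨h1, h2, h3, h4, h5⟩ := hi
  exact ⟨h1, h2.trans hk, h3, hu.trans h4, h5.trans_le hv⟩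

lemma vol_add_le {k u v w : ℕ} (huv : u ≤ v) (hvw : v ≤ w) :
    vol x c s q k u v + vol x c s q k v w ≤ vol x c s q k u w := by
  classical
  unfold vol
  rw [← Finset.sum_union]
  · refine Finset.sum_le_sum_of_subset fun i hi => ?_
    simp only [Finset.mem_union, Finset.mem_filter, Finset.mem_univ, true_and] at hi ⊢
    rcases hi with ⟨h1, h2, h3, h4, h5⟩ | ⟨h1, h2, h3, h4, h5⟩
    · exact ⟨h1, h2, h3, h4, h5.trans_le hvw⟩
    · exact ⟨h1, h2, h3, huv.trans h4, h5⟩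
  · refine Finset.disjoint_left.2 fun i hi hi' => ?_
    simp only [Finset.mem_filter] at hi hi'
    omega

lemma two_pow_le_vol_of_mem {k u v : ℕ} {i : Fin n} (hi : i.1 < s) (hc : c i ≤ k)
    (hq : (x i).2 = q) (hu : u ≤ (x i).1.b) (hv : (x i).1.b < v) :
    2 ^ c i ≤ vol x c s q k u v :=
  Finset.single_le_sum (f := fun i => 2 ^ c i) (fun _ _ => Nat.zero_le _)
    (by simp only [Finset.mem_filter, Finset.mem_univ, true_and]; exact ⟨hi, hc, hq, hu, hv⟩)

/-- If all the intervals of length `2 ^ k` of a copy of `S_h` are occupied on a machine, then the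
jobs of size class at most `k` placed there have volume at least `2 ^ h`. The reason is that a job
of class `c < k` in an interval of length `2 ^ k` found all the intervals of length `2 ^ c` in the
subtree below it occupied. -/
lemma Inv.two_pow_le_vol (hinv : Inv x a c L s A T) {B : Block} (hB : B ∈ A) {h u k : ℕ}
    (ht : tree h u ⊆ tree B.k B.t) (hTu : T ≤ u) (hkh : k ≤ h)
    (hocc : ∀ J ∈ tree h u, J.length = 2 ^ k → Occ x s J q) :
    2 ^ h ≤ vol x c s q k u (u + treeLen h) := by
  induction h generalizing u k with
  | zero =>
    obtain rfl : k = 0 := by omega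
    obtain ⟨i, hi, hx⟩ := hocc _ (root_mem_tree 0 u) (root_length 0 u)
    have hf := hinv.fits i hi
    rw [hx, root_length] at hf
    have hc : c i ≤ 0 := (Nat.pow_le_pow_iff_right (by norm_num)).1 hf
    have h1 := root_b_lt 0 u
    have h2 := le_root_b 0 u
    refine le_trans Nat.one_le_two_pow (two_pow_le_vol_of_mem (u := u) (v := u + treeLen 0)
      (q := q) hi hc ?_ ?_ ?_) <;> simp [hx, h1, h2]
  | succ h ih =>
    have hl := treeLen_add_self_le h
    have ht1 : tree h u ⊆ tree (h + 1) u := tree_mono u (Nat.le_succ h)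
    have ht2 : tree h (u + treeLen h) ⊆ tree (h + 1) u :=
      fun _ hJ => mem_tree_succ.2 (Or.inr (Or.inl hJ))
    have children : ∀ k' ≤ h, k' ≤ k →
        (∀ J ∈ tree (h + 1) u, J.b < (root (h + 1) u).b → J.length = 2 ^ k' → Occ x s J q) →
        2 ^ (h + 1) ≤ vol x c s q k u (u + treeLen (h + 1)) := by
      intro k' hk' hk'k ho
      have hrb := root_succ_b h u
      have v1 := ih (ht1.trans ht) hTu hk' fun J hJ => ho J (ht1 hJ) (by
        have := bounds_of_mem_tree hJ; omega)
      have v2 := ih (ht2.trans ht) (by omega) hk' fun J hJ => ho J (ht2 hJ) (by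
        have := bounds_of_mem_tree hJ; omega)
      have v3 : vol x c s q k' u (u + treeLen h) +
          vol x c s q k' (u + treeLen h) (u + treeLen h + treeLen h) ≤ _ :=
        vol_add_le (by omega) (by omega)
      have v4 : vol x c s q k' u (u + treeLen h + treeLen h) ≤
          vol x c s q k u (u + treeLen (h + 1)) := vol_mono hk'k le_rfl (by omega)
      rw [pow_succ]; omega
    rcases hkh.eq_or_lt with rfl | hlt
    · obtain ⟨i, hi, hx⟩ := hocc _ (root_mem_tree (h + 1) u) (root_length (h + 1) u)
      have hf := hinv.fits i hi
      rw [hx, root_length] at hf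
      have hc : c i ≤ h + 1 := (Nat.pow_le_pow_iff_right (by norm_num)).1 hf
      rcases hc.eq_or_lt with hc' | hc'
      · have h1 := root_b_lt (h + 1) u
        have h2 := le_root_b (h + 1) u
        rw [← hc']
        refine two_pow_le_vol_of_mem hi le_rfl ?_ ?_ ?_ <;> simp [hx, hc', h1, h2]
      · obtain ⟨B', hB', hm, hJ⟩ := hinv.placed i hi
        rw [hx] at hm hJ
        obtain rfl := hinv.chained.block_unique hB hB' (ht (root_mem_tree _ _)) hm
        refine children (c i) (by omega) hc fun J hJt hJb hJl => hJ J (ht hJt) ?_ hJb hJl.ge q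
        have h1 := bounds_of_mem_tree hJt
        have h2 := hinv.arrival_le i hi
        omega
    · exact children k (by omega) le_rfl fun J hJ _ => hocc J hJ

/-- In a copy of `S_h` that starts at `T` or later, let all the intervals of length `2 ^ k` before `I`
be occupied on machine `q`. Then the copies of `S_k` that are over before `I` carry a volume
proportional to their number, so that the end of `I` is controlled by the volume before it. -/
lemma Inv.e_le_of_le_start (hinv : Inv x a c L s A T) {B : Block} (hB : B ∈ A) {h u k : ℕ}
    {I : Slot} (ht : tree h u ⊆ tree B.k B.t) (hTu : T ≤ u) (hI : I ∈ tree h u)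
    (hk : 2 ^ k ≤ I.length)
    (hocc : ∀ J ∈ tree h u, J.b < I.b → J.length = 2 ^ k → Occ x s J q) :
    I.e ≤ u + (h + 1) * (2 ^ k + vol x c s q k u I.b) := by
  have hkh := le_of_mem_tree hI hk
  induction h generalizing u with
  | zero =>
    obtain rfl : I = root 0 u := hI
    rw [root_e]
    have : 0 < 2 ^ k := by positivity
    simp only [treeLen]; omega
  | succ h ih =>
    have ht1 : tree h u ⊆ tree (h + 1) u := tree_mono u (Nat.le_succ h)
    have ht2 : tree h (u + treeLen h) ⊆ tree (h + 1) u :=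
      fun _ hJ => mem_tree_succ.2 (Or.inr (Or.inl hJ))
    rcases mem_tree_succ.1 hI with hI' | hI' | rfl
    · have h1 := ih (ht1.trans ht) hTu hI' (fun J hJ => hocc J (ht1 hJ)) (le_of_mem_tree hI' hk)
      exact h1.trans (by gcongr; omega)
    · have hk' := le_of_mem_tree hI' hk
      have h0 := bounds_of_mem_tree hI'
      have h1 := ih (ht2.trans ht) (by omega) hI' (fun J hJ => hocc J (ht2 hJ)) hk'
      have h2 := hinv.two_pow_le_vol (q := q) hB (ht1.trans ht) hTu hk' fun J hJ => hocc J (ht1 hJ)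
        (by have := bounds_of_mem_tree hJ; omega)
      have h3 : vol x c s q k u (u + treeLen h) + vol x c s q k (u + treeLen h) I.b ≤ _ :=
        vol_add_le (by omega) h0.1
      have h4 : treeLen h ≤ (h + 1) * vol x c s q k u (u + treeLen h) := Nat.mul_le_mul_left _ h2
      generalize vol x c s q k u (u + treeLen h) = v1 at *
      generalize vol x c s q k (u + treeLen h) I.b = v2 at *
      generalize vol x c s q k u I.b = v3 at *
      generalize 2 ^ k = K at *
      nlinarith
    · rw [root_e]
      refine Nat.add_le_add_left (Nat.mul_le_mul_left _ ?_) _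
      rcases hkh.eq_or_lt with rfl | hlt
      · exact Nat.le_add_right _ _
      have hb := root_succ_b h u
      have h1 := hinv.two_pow_le_vol (q := q) hB (ht1.trans ht) hTu (by omega : k ≤ h)
        fun J hJ => hocc J (ht1 hJ) (by have := bounds_of_mem_tree hJ; omega)
      have h2 := hinv.two_pow_le_vol (q := q) hB (ht2.trans ht) (by omega) (by omega : k ≤ h)
        fun J hJ => hocc J (ht2 hJ) (by have := bounds_of_mem_tree hJ; omega)
      have h3 : vol x c s q k u (u + treeLen h) +
          vol x c s q k (u + treeLen h) (u + treeLen h + treeLen h) ≤ _ :=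
        vol_add_le (by omega) (by omega)
      have hK : 0 < 2 ^ k := by positivity
      rw [hb, pow_succ]; omega

/-- The length of a copy of `S_h` that starts by time `T` is controlled by the time that has passed
since its start, by `2 ^ k` and by the volume after `T`: if `k < h`, then either the first of the two
copies of `S_{h-1}` is already over at time `T`, or the second one lies entirely after `T`. -/
lemma Inv.treeLen_le (hinv : Inv x a c L s A T) {B : Block} (hB : B ∈ A) {h u k v : ℕ}
    (ht : tree h u ⊆ tree B.k B.t) (huT : u ≤ T)
    (hv : ∀ h', h = h' + 1 → u + treeLen h' + treeLen h' ≤ v)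
    (hocc : ∀ J ∈ tree h u, T ≤ J.b → J.b < (root h u).b → J.length = 2 ^ k → Occ x s J q) :
    treeLen h ≤ 2 * (h + 1) * ((T - u) + 2 ^ k + vol x c s q k T v) := by
  have hmul : ∀ {y}, 2 ^ h ≤ 2 * y → treeLen h ≤ 2 * (h + 1) * y := fun {y} hy => by
    have := Nat.mul_le_mul_left (h + 1) hy
    simp only [treeLen]; nlinarith
  apply hmul
  have hK : 0 < 2 ^ k := by positivity
  by_cases hkh : h ≤ k
  · have : 2 ^ h ≤ 2 ^ k := Nat.pow_le_pow_right (by norm_num) hkh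
    omega
  obtain ⟨h, rfl⟩ : ∃ h', h = h' + 1 := ⟨h - 1, by omega⟩
  have hv := hv h rfl
  have hp : 2 ^ (h + 1) = 2 * 2 ^ h := by rw [pow_succ]; ring
  have ht2 : tree h (u + treeLen h) ⊆ tree (h + 1) u :=
    fun _ hJ => mem_tree_succ.2 (Or.inr (Or.inl hJ))
  rcases le_total T (u + treeLen h) with hT | hT
  · have hb := root_succ_b h u
    have h1 := hinv.two_pow_le_vol (q := q) hB (ht2.trans ht) hT (by omega : k ≤ h)
      fun J hJ => by
        have := bounds_of_mem_tree hJ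
        exact hocc J (ht2 hJ) (by omega) (by omega)
    have h2 : vol x c s q k (u + treeLen h) (u + treeLen h + treeLen h) ≤ vol x c s q k T v :=
      vol_mono le_rfl hT (by omega)
    omega
  · have : 2 ^ h ≤ treeLen h := Nat.le_mul_of_pos_left _ (Nat.succ_pos h)
    omega

/-- The counterpart of `Inv.e_le_of_le_start` for a copy of `S_h` that starts by time `T`. -/
lemma Inv.e_le_of_start_le (hinv : Inv x a c L s A T) {B : Block} (hB : B ∈ A) {h u k : ℕ}
    {I : Slot} (ht : tree h u ⊆ tree B.k B.t) (huT : u ≤ T) (hI : I ∈ tree h u) (hTI : T ≤ I.b)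
    (hk : 2 ^ k ≤ I.length)
    (hocc : ∀ J ∈ tree h u, T ≤ J.b → J.b < I.b → J.length = 2 ^ k → Occ x s J q) :
    I.e ≤ u + 3 * (h + 1) * ((T - u) + 2 ^ k + vol x c s q k T I.b) := by
  have hroot : ∀ {h u : ℕ}, tree h u ⊆ tree B.k B.t → u ≤ T →
      (∀ J ∈ tree h u, T ≤ J.b → J.b < (root h u).b → J.length = 2 ^ k → Occ x s J q) →
      (root h u).e ≤ u + 3 * (h + 1) * ((T - u) + 2 ^ k + vol x c s q k T (root h u).b) := by
    intro h u ht huT hocc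
    rw [root_e]
    refine Nat.add_le_add_left ((hinv.treeLen_le (v := (root h u).b) hB ht huT ?_ hocc).trans ?_) _
    · rintro h' rfl
      rw [root_succ_b]
    · gcongr; omega
  induction h generalizing u with
  | zero =>
    obtain rfl : I = root 0 u := hI
    exact hroot ht huT hocc
  | succ h ih =>
    have ht1 : tree h u ⊆ tree (h + 1) u := tree_mono u (Nat.le_succ h)
    have ht2 : tree h (u + treeLen h) ⊆ tree (h + 1) u :=
      fun _ hJ => mem_tree_succ.2 (Or.inr (Or.inl hJ))
    rcases mem_tree_succ.1 hI with hI' | hI' | rfl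
    · have h1 := ih (ht1.trans ht) huT hI' fun J hJ => hocc J (ht1 hJ)
      exact h1.trans (by gcongr; omega)
    · have h0 := bounds_of_mem_tree hI'
      rcases le_total T (u + treeLen h) with hT | hT
      · have h1 := hinv.treeLen_le (q := q) (k := k) (v := u + treeLen h) hB (ht1.trans ht) huT
          (by rintro h' rfl; have := treeLen_add_self_le h'; omega)
          fun J hJ hTJ hJr => hocc J (ht1 hJ) hTJ (by
            have := bounds_of_mem_tree hJ; omega)
        have h2 := hinv.e_le_of_le_start (q := q) hB (ht2.trans ht) hT hI' hk fun J hJ =>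
          hocc J (ht2 hJ) (by have := bounds_of_mem_tree hJ; omega)
        have h3 : vol x c s q k T (u + treeLen h) + vol x c s q k (u + treeLen h) I.b ≤ _ :=
          vol_add_le hT h0.1
        generalize vol x c s q k T (u + treeLen h) = v1 at *
        generalize vol x c s q k (u + treeLen h) I.b = v2 at *
        generalize vol x c s q k T I.b = v3 at *
        generalize 2 ^ k = K at *
        generalize T - u = D at *
        nlinarith
      · have h1 := ih (ht2.trans ht) hT hI' fun J hJ => hocc J (ht2 hJ)
        obtain ⟨D, rfl⟩ := Nat.exists_eq_add_of_le hT
        have h2 : u + treeLen h + D - u = treeLen h + D := by omega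
        rw [Nat.add_sub_cancel_left] at h1
        rw [h2]
        generalize vol x c s q k (u + treeLen h + D) I.b = v1 at *
        generalize 2 ^ k = K at *
        generalize treeLen h = l at *
        nlinarith
    · exact hroot ht huT hocc

/-- The start of a sequence of the state is controlled by `T` and by the volume between `T` and this
start, provided that the longer intervals in between are occupied. For a sequence of `S_d` that lies
after `T` and is followed by another one, either the intervals of length `2 ^ k` are all occupied,
or `d < k` and the last interval is occupied; both give volume `2 ^ d`, against the length
`(d + 1) 2 ^ d`. -/
lemma Inv.start_le (hinv : Inv x a c L s A T) {k : ℕ} {B : Block} {A' : State}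
    (hch : Chained (fun I => ∀ q, Occ x s I q) T (B :: A')) (hA' : ∀ B' ∈ A', B' ∈ A)
    (hocc : ∀ B' ∈ A', ∀ J ∈ tree B'.k B'.t, T ≤ J.b → J.b < B.t → J.length = 2 ^ k → Occ x s J q) :
    B.t ≤ T + 2 * (L + 1) * (T + 2 ^ k + vol x c s q k T B.t) := by
  induction A' generalizing B with
  | nil => exact (show B.t ≤ T from hch).trans (Nat.le_add_right _ _)
  | cons B' A' ih =>
    obtain ⟨h1, h2, h3⟩ := hch
    have hB' := hA' B' List.mem_cons_self
    have hkL := hinv.k_le B' hB'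
    by_cases hBT : B.t ≤ T
    · exact hBT.trans (Nat.le_add_right _ _)
    obtain ⟨h2, h4⟩ := h2.resolve_left hBT
    have hin : ∀ J ∈ tree B'.k B'.t, J.b < B.t := fun J hJ => by
      have := bounds_of_mem_tree hJ; omega
    rcases le_total T B'.t with hT | hT
    · have h5 := ih h3 (fun B'' h => hA' B'' (List.mem_cons_of_mem _ h)) fun B'' h J hJ hTJ hJB =>
        hocc B'' (List.mem_cons_of_mem _ h) J hJ hTJ (by omega)
      have h6 : 2 ^ B'.k ≤ vol x c s q k B'.t B.t := by
        rw [h2]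
        by_cases hkB : k ≤ B'.k
        · refine hinv.two_pow_le_vol hB' le_rfl hT hkB fun J hJ => ?_
          have := bounds_of_mem_tree hJ
          exact hocc B' List.mem_cons_self J hJ (by omega) (hin J hJ)
        · refine (hinv.two_pow_le_vol hB' le_rfl hT le_rfl fun J hJ hJl => ?_).trans
            (vol_mono (not_le.1 hkB).le le_rfl le_rfl)
          rw [eq_root_of_mem_tree hJ hJl.ge]
          exact h4 hT q
      have h7 : treeLen B'.k ≤ (L + 1) * vol x c s q k B'.t B.t :=
        Nat.mul_le_mul (by omega) h6
      have h8 : vol x c s q k T B'.t + vol x c s q k B'.t B.t ≤ _ := vol_add_le hT (by omega)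
      generalize vol x c s q k T B'.t = v1 at *
      generalize vol x c s q k B'.t B.t = v2 at *
      generalize vol x c s q k T B.t = v3 at *
      generalize 2 ^ k = K at *
      nlinarith
    · have h5 := hinv.treeLen_le (q := q) (k := k) (v := B.t) hB' le_rfl hT
        (by rintro h' hh
            have := treeLen_add_self_le h'
            rw [← hh] at this
            omega)
        fun J hJ hTJ _ => hocc B' List.mem_cons_self J hJ hTJ (hin J hJ)
      have h6 : 2 * (B'.k + 1) * (T - B'.t + 2 ^ k + vol x c s q k T B.t) ≤
          2 * (L + 1) * (T + 2 ^ k + vol x c s q k T B.t) := by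
        gcongr; omega
      omega

lemma Chained.exists_suffix {occ : Slot → Prop} (h : Chained occ T A) {B : Block} (hB : B ∈ A) :
    ∃ A', Chained occ T (B :: A') ∧ ∀ B' ∈ A', B' ∈ A := by
  induction A with
  | nil => simp at hB
  | cons B₀ A ih =>
    rcases List.mem_cons.1 hB with rfl | hB
    · exact ⟨A, h, fun _ => List.mem_cons_of_mem _⟩
    · obtain ⟨A', h1, h2⟩ := ih h.tail hB
      exact ⟨A', h1, fun B' h => List.mem_cons_of_mem _ (h2 B' h)⟩

/-- The end of an interval before which all the intervals of length `2 ^ k` that start at `T` or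
later are occupied. -/
lemma Inv.e_le (hinv : Inv x a c L s A T) {B : Block} (hB : B ∈ A) {k : ℕ} {I : Slot}
    (hI : I ∈ tree B.k B.t) (hTI : T ≤ I.b) (hk : 2 ^ k ≤ I.length)
    (hocc : ∀ B' ∈ A, ∀ J ∈ tree B'.k B'.t, T ≤ J.b → J.b < I.b → J.length = 2 ^ k → Occ x s J q) :
    I.e ≤ 4 * (L + 1) * (T + 2 ^ k + vol x c s q k T I.b) := by
  have h0 := bounds_of_mem_tree hI
  have hkL := hinv.k_le B hB
  rcases le_total T B.t with hT | hT
  · obtain ⟨A', hch, hA'⟩ := hinv.chained.exists_suffix hB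
    have h1 := hinv.start_le (k := k) (q := q) hch hA' fun B' hB' J hJ hTJ hJB =>
      hocc B' (hA' B' hB') J hJ hTJ (hJB.trans_le h0.1)
    have h2 := hinv.e_le_of_le_start (q := q) hB le_rfl hT hI hk fun J hJ =>
      hocc B hB J hJ (by have := bounds_of_mem_tree hJ; omega)
    have h3 : vol x c s q k T B.t + vol x c s q k B.t I.b ≤ _ := vol_add_le hT h0.1
    have h4 : (B.k + 1) * (2 ^ k + vol x c s q k B.t I.b) ≤
        (L + 1) * (2 ^ k + vol x c s q k B.t I.b) := by gcongr
    generalize vol x c s q k T B.t = v1 at *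
    generalize vol x c s q k B.t I.b = v2 at *
    generalize vol x c s q k T I.b = v3 at *
    generalize 2 ^ k = K at *
    nlinarith
  · have h1 := hinv.e_le_of_start_le (q := q) hB le_rfl hT hI hTI hk (hocc B hB)
    have h2 : 3 * (B.k + 1) * (T - B.t + 2 ^ k + vol x c s q k T I.b) ≤
        3 * (L + 1) * (T + 2 ^ k + vol x c s q k T I.b) := by gcongr; omega
    have h3 : T ≤ (L + 1) * (T + 2 ^ k + vol x c s q k T I.b) :=
      le_trans (by rw [add_assoc]; exact Nat.le_add_right _ _)
        (Nat.le_mul_of_pos_left _ (Nat.succ_pos L))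
    linarith

end Volume

/-- The completion time of a job in a run of the mechanism, in terms of its arrival, of its size and
of the average over the machines of the volume of the jobs that came before it and are not of a
larger size class. -/
lemma IsRun.mul_completion_le {m n : ℕ} (hm : 1 ≤ m) {σ : Input n} {x : Fin n → Slot × Fin m}
    (hx : IsRun σ x) {L : ℕ} (hL : ∀ j, σ.cls j ≤ L) (j : Fin n) :
    m * completion σ x j ≤ 4 * (L + 1) * (m * (σ.arrival j + 2 ^ σ.cls j) +
      ∑ i with i ≤ j ∧ σ.cls i ≤ σ.cls j, 2 ^ σ.cls i) := by
  classical
  obtain ⟨A, hinv, hocc⟩ := hx.inv_after hm hL j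
  obtain ⟨B, hB, hI, -⟩ := hinv.placed j (Nat.lt_succ_self _)
  obtain ⟨-, h1, h2, -⟩ := hx.step hm j
  have h3 : ∀ q : Fin m, completion σ x j ≤ 4 * (L + 1) * (σ.arrival j + 2 ^ σ.cls j +
      vol x σ.cls (j + 1) q (σ.cls j) (σ.arrival j) (x j).1.b) := by
    intro q
    refine le_trans ?_ (hinv.e_le (q := q) hB hI h1 h2 fun B' hB' J hJ hTJ hJI hJl =>
      hocc B' hB' J hJ hTJ hJI hJl.ge q)
    have h4 := σ.p_le j
    have h5 := bounds_of_mem_tree hI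
    simp only [completion, Slot.length] at h2 ⊢
    omega
  have h4 : ∑ q : Fin m, vol x σ.cls (j + 1) q (σ.cls j) (σ.arrival j) (x j).1.b ≤
      ∑ i with i ≤ j ∧ σ.cls i ≤ σ.cls j, 2 ^ σ.cls i := by
    simp only [vol]
    rw [← Finset.sum_biUnion]
    · refine Finset.sum_le_sum_of_subset fun i hi => ?_
      simp only [Finset.mem_biUnion, Finset.mem_filter, Finset.mem_univ, true_and] at hi ⊢
      obtain ⟨q, h1, h2, -⟩ := hi
      exact ⟨Fin.le_def.2 (Nat.lt_succ_iff.1 h1), h2⟩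
    · intro q _ q' _ hne
      refine Finset.disjoint_left.2 fun i hi hi' => hne ?_
      simp only [Finset.mem_filter] at hi hi'
      exact hi.2.2.2.1.symm.trans hi'.2.2.2.1
  calc m * completion σ x j = ∑ _q : Fin m, completion σ x j := by simp
    _ ≤ ∑ q : Fin m, 4 * (L + 1) * (σ.arrival j + 2 ^ σ.cls j +
      vol x σ.cls (j + 1) q (σ.cls j) (σ.arrival j) (x j).1.b) := Finset.sum_le_sum fun q _ => h3 q
    _ = 4 * (L + 1) * (m * (σ.arrival j + 2 ^ σ.cls j) +
      ∑ q : Fin m, vol x σ.cls (j + 1) q (σ.cls j) (σ.arrival j) (x j).1.b) := by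
        rw [← Finset.mul_sum, Finset.sum_add_distrib]; simp
    _ ≤ _ := by gcongr

/-! ### Lower bounds for SRPT -/

section Srpt

variable {m n : ℕ} {σ : Input n}

lemma SrptRuns.of_le {rem : Fin n → ℕ} {t : ℕ} {i j : Fin n} (h : SrptRuns m σ rem t j)
    (hij : i ≤ j) (hrem : rem i ≤ rem j) (hi : 0 < rem i) : SrptRuns m σ rem t i := by
  refine ⟨⟨(σ.r_mono hij).trans h.1.1, hi⟩, lt_of_le_of_lt (Finset.card_le_card ?_) h.2⟩
  intro l hl
  simp only [Finset.mem_filter, Finset.mem_univ, true_and] at hl ⊢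
  refine ⟨hl.1, ?_⟩
  omega

/-- A job that comes first and is not longer never falls behind. -/
lemma srptRemaining_le_of_le {i j : Fin n} (hij : i ≤ j) (hp : σ.p i ≤ σ.p j) (t : ℕ) :
    srptRemaining m σ t i ≤ srptRemaining m σ t j := by
  induction t with
  | zero => exact hp
  | succ t ih =>
    simp only [srptRemaining]
    by_cases hj : SrptRuns m σ (srptRemaining m σ t) t j
    · rw [if_pos hj]
      rcases Nat.eq_zero_or_pos (srptRemaining m σ t i) with h0 | h0
      · split_ifs <;> omega
      · rw [if_pos (hj.of_le hij ih h0)]; omega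
    · rw [if_neg hj]
      split_ifs <;> omega

open Classical in
lemma card_srptRuns_le (rem : Fin n → ℕ) (t : ℕ) :
    (Finset.univ.filter fun j => SrptRuns m σ rem t j).card ≤ m := by
  rcases (Finset.univ.filter fun j => SrptRuns m σ rem t j).eq_empty_or_nonempty with h | h
  · simp [h]
  -- all the other running jobs have priority over the one of lowest priority
  obtain ⟨j, hj, hmax⟩ := Finset.exists_max_image _ (fun j => toLex (rem j, j)) h
  have hj' := (Finset.mem_filter.1 hj).2
  have hsub : (Finset.univ.filter fun j => SrptRuns m σ rem t j).erase j ⊆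
      Finset.univ.filter fun i : Fin n =>
        IsPending σ rem t i ∧ (rem i < rem j ∨ (rem i = rem j ∧ i < j)) := by
    intro i hi
    obtain ⟨hne, hi⟩ := Finset.mem_erase.1 hi
    have h1 := hmax i hi
    rw [Prod.Lex.toLex_le_toLex] at h1
    simp only [Finset.mem_filter, Finset.mem_univ, true_and] at hi ⊢
    exact ⟨hi.1, h1.imp_right fun h => ⟨h.1, lt_of_le_of_ne h.2 hne⟩⟩
  have h1 := Finset.card_le_card hsub
  rw [Finset.card_erase_of_mem hj] at h1
  have h2 := hj'.2
  omega

lemma sum_p_le_srptRemaining (F : Finset (Fin n)) (t : ℕ) :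
    ∑ i ∈ F, σ.p i ≤ ∑ i ∈ F, srptRemaining m σ t i + m * t := by
  classical
  induction t with
  | zero => simp [srptRemaining]
  | succ t ih =>
    have h1 : ∑ i ∈ F, srptRemaining m σ t i ≤ ∑ i ∈ F, (srptRemaining m σ (t + 1) i +
        if SrptRuns m σ (srptRemaining m σ t) t i then 1 else 0) := by
      refine Finset.sum_le_sum fun i _ => ?_
      simp only [srptRemaining]
      split_ifs <;> omega
    have h2 : (∑ i ∈ F, if SrptRuns m σ (srptRemaining m σ t) t i then 1 else 0) ≤ m := by
      rw [← Finset.card_filter]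
      exact (Finset.card_le_card (Finset.filter_subset_filter _ (Finset.subset_univ F))).trans
        (card_srptRuns_le _ t)
    rw [Finset.sum_add_distrib] at h1
    rw [Nat.mul_succ]; omega

lemma p_le_srptRemaining {j : Fin n} {a : ℕ} (ha : σ.r j = a) (t : ℕ) :
    σ.p j ≤ srptRemaining m σ t j + (t - a) := by
  induction t with
  | zero => simp [srptRemaining]
  | succ t ih =>
    simp only [srptRemaining]
    split_ifs with hr
    · have h1 : (a : ℝ) ≤ t := ha ▸ hr.1.1
      have h2 : a ≤ t := by exact_mod_cast h1
      omega
    · omega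

/-- Once all the jobs are released, SRPT makes progress until all of them are finished. -/
lemma exists_srptRemaining_eq_zero (hm : 1 ≤ m) (j : Fin n) : ∃ t, srptRemaining m σ t j = 0 := by
  classical
  obtain ⟨T, hT⟩ : ∃ T : ℕ, ∀ i, σ.r i ≤ T := by
    obtain ⟨T, hT⟩ := exists_nat_ge (∑ i, σ.r i)
    exact ⟨T, fun i =>
      (Finset.single_le_sum (fun i _ => σ.r_nonneg i) (Finset.mem_univ i)).trans hT⟩
  have hdec : ∀ t i, srptRemaining m σ (t + 1) i ≤ srptRemaining m σ t i := by
    intro t i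
    simp only [srptRemaining]
    split_ifs <;> omega
  have hprog : ∀ t, T ≤ t → 0 < ∑ i, srptRemaining m σ t i →
      ∑ i, srptRemaining m σ (t + 1) i < ∑ i, srptRemaining m σ t i := by
    intro t ht hpos
    have hne : (Finset.univ.filter fun i => 0 < srptRemaining m σ t i).Nonempty := by
      obtain ⟨i, hi, h0⟩ := Finset.exists_ne_zero_of_sum_ne_zero hpos.ne'
      exact ⟨i, by simpa [Nat.pos_iff_ne_zero] using h0⟩
    obtain ⟨i, hi, hmin⟩ :=
      Finset.exists_min_image _ (fun i => toLex (srptRemaining m σ t i, i)) hne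
    have hi0 := (Finset.mem_filter.1 hi).2
    have hrun : SrptRuns m σ (srptRemaining m σ t) t i := by
      refine ⟨⟨(hT i).trans (by exact_mod_cast ht), hi0⟩, ?_⟩
      rw [Finset.card_eq_zero.2]
      · exact hm
      refine Finset.filter_eq_empty_iff.2 fun l _ hl => ?_
      have h1 := hmin l (by simpa using hl.1.2)
      simp only [Prod.Lex.toLex_le_toLex] at h1
      have h2 := hl.2
      omega
    refine Finset.sum_lt_sum (fun l _ => hdec t l) ⟨i, Finset.mem_univ i, ?_⟩
    simp only [srptRemaining, if_pos hrun]; omega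
  have hall : ∀ s, ∑ i, srptRemaining m σ (T + s) i ≤ (∑ i, srptRemaining m σ T i) - s := by
    intro s
    induction s with
    | zero => simp
    | succ s ih =>
      rcases Nat.eq_zero_or_pos (∑ i, srptRemaining m σ (T + s) i) with h0 | h0
      · have := Finset.sum_le_sum fun i (_ : i ∈ Finset.univ) => hdec (T + s) i
        rw [← add_assoc]; omega
      · have := hprog (T + s) (by omega) h0
        rw [← add_assoc]; omega
  refine ⟨T + ∑ i, srptRemaining m σ T i, ?_⟩
  have h1 := hall (∑ i, srptRemaining m σ T i)
  have h2 := Finset.single_le_sum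
    (f := fun i => srptRemaining m σ (T + ∑ i, srptRemaining m σ T i) i)
    (fun _ _ => Nat.zero_le _) (Finset.mem_univ j)
  omega

lemma srptRemaining_srptCompletion (hm : 1 ≤ m) (j : Fin n) :
    srptRemaining m σ (srptCompletion m σ j) j = 0 :=
  Nat.sInf_mem (s := {t | srptRemaining m σ t j = 0}) (exists_srptRemaining_eq_zero hm j)

lemma add_p_le_srptCompletion (hm : 1 ≤ m) {j : Fin n} {a : ℕ} (ha : σ.r j = a) :
    a + σ.p j ≤ srptCompletion m σ j := by
  have h1 := p_le_srptRemaining (m := m) ha (srptCompletion m σ j)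
  have h2 := σ.p_pos j
  rw [srptRemaining_srptCompletion hm] at h1
  omega

/-- SRPT finishes the earlier jobs that are not longer than `j` no later than `j`. -/
lemma sum_p_le_mul_srptCompletion (hm : 1 ≤ m) (j : Fin n) :
    ∑ i with i ≤ j ∧ σ.p i ≤ σ.p j, σ.p i ≤ m * srptCompletion m σ j := by
  refine (sum_p_le_srptRemaining (m := m) _ (srptCompletion m σ j)).trans ?_
  rw [Finset.sum_eq_zero, zero_add]
  intro i hi
  have h1 := (Finset.mem_filter.1 hi).2
  have h2 := srptRemaining_le_of_le (m := m) h1.1 h1.2 (srptCompletion m σ j)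
  rw [srptRemaining_srptCompletion hm] at h2
  exact Nat.le_zero.1 h2

end Srpt

/-! ### Lower bounds for preemptive schedules -/

namespace PreemptiveSchedule

variable {m n : ℕ} {σ : Input n} (S : PreemptiveSchedule m σ)

lemma r_add_p_le_completion (j : Fin n) : σ.r j + σ.p j ≤ S.completion j := by
  refine le_csInf (S.finishes j) fun t ht => ?_
  have h1 : processedBy S.run j t ≤ ENNReal.ofReal (t - σ.r j) := by
    rw [← Real.volume_Icc]
    refine MeasureTheory.measure_mono fun y hy => ?_
    obtain ⟨hyt, q, hq⟩ := hy
    exact ⟨S.released q y j hq, hyt⟩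
  have h2 : ENNReal.ofReal (σ.p j) ≤ ENNReal.ofReal (t - σ.r j) := by
    rw [ENNReal.ofReal_natCast]; exact le_trans ht h1
  have h3 : (0 : ℝ) < σ.p j := by exact_mod_cast σ.p_pos j
  rcases ENNReal.ofReal_le_ofReal_iff'.1 h2 with h | h <;> linarith

lemma sum_processedBy_le (F : Finset (Fin n)) (t : ℝ) :
    ∑ i ∈ F, processedBy S.run i t ≤ m * ENNReal.ofReal t := by
  have h1 : ∀ i, processedBy S.run i t ≤
      ∑ q, MeasureTheory.volume (Set.Iic t ∩ {y | S.run q y = some i}) := by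
    intro i
    refine le_trans (MeasureTheory.measure_mono fun y hy => ?_)
      (MeasureTheory.measure_iUnion_fintype_le _ _)
    obtain ⟨hyt, q, hq⟩ := hy
    exact Set.mem_iUnion.2 ⟨q, hyt, hq⟩
  have h2 : ∀ q, ∑ i ∈ F, MeasureTheory.volume (Set.Iic t ∩ {y | S.run q y = some i}) ≤
      ENNReal.ofReal t := by
    intro q
    rw [← MeasureTheory.measure_biUnion_finset]
    · rw [← sub_zero t, ← Real.volume_Icc, sub_zero]
      refine MeasureTheory.measure_mono fun y hy => ?_
      simp only [Set.mem_iUnion] at hy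
      obtain ⟨i, -, hyt, hq⟩ := hy
      exact ⟨(σ.r_nonneg i).trans (S.released q y i hq), hyt⟩
    · intro i _ i' _ hne
      refine Set.disjoint_left.2 fun y hy hy' => hne ?_
      exact Option.some.inj (hy.2.symm.trans hy'.2)
    · exact fun i _ => measurableSet_Iic.inter (S.measurable q i)
  calc ∑ i ∈ F, processedBy S.run i t
      ≤ ∑ i ∈ F, ∑ q, MeasureTheory.volume (Set.Iic t ∩ {y | S.run q y = some i}) :=
        Finset.sum_le_sum fun i _ => h1 i
    _ = ∑ q, ∑ i ∈ F, MeasureTheory.volume (Set.Iic t ∩ {y | S.run q y = some i}) :=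
        Finset.sum_comm
    _ ≤ ∑ _q : Fin m, ENNReal.ofReal t := Finset.sum_le_sum fun q _ => h2 q
    _ = m * ENNReal.ofReal t := by simp

/-- By the completion of job `j` the machines have processed all the jobs that complete no later
than `j`. -/
lemma sum_p_le_mul_completion (hm : 1 ≤ m) (j : Fin n) :
    ∑ i with S.completion i ≤ S.completion j, (σ.p i : ℝ) ≤ m * S.completion j := by
  have hm' : (0 : ℝ) < m := by exact_mod_cast hm
  rw [← div_le_iff₀' hm']
  refine le_of_forall_gt_imp_ge_of_dense fun t ht => ?_
  rw [div_le_iff₀' hm']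
  have ht0 : 0 ≤ t := by
    have h1 := S.r_add_p_le_completion j
    have h2 := σ.r_nonneg j
    have h3 : (0 : ℝ) ≤ σ.p j := Nat.cast_nonneg _
    linarith
  have h1 : ∑ i with S.completion i ≤ S.completion j, (σ.p i : ℝ≥0∞) ≤
      ∑ i with S.completion i ≤ S.completion j, processedBy S.run i t := by
    refine Finset.sum_le_sum fun i hi => ?_
    obtain ⟨t', ht', hlt⟩ := exists_lt_of_csInf_lt (S.finishes i)
      ((Finset.mem_filter.1 hi).2.trans_lt ht)
    refine le_trans ht' (MeasureTheory.measure_mono fun y hy => ⟨hy.1.trans hlt.le, hy.2⟩)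
  have h2 := h1.trans (S.sum_processedBy_le _ t)
  have h3 : ENNReal.ofReal (∑ i with S.completion i ≤ S.completion j, (σ.p i : ℝ)) ≤
      ENNReal.ofReal (m * t) := by
    rw [ENNReal.ofReal_sum_of_nonneg fun _ _ => Nat.cast_nonneg _,
      ENNReal.ofReal_mul hm'.le]
    simpa only [ENNReal.ofReal_natCast] using h2
  exact (ENNReal.ofReal_le_ofReal_iff (by positivity)).1 h3

/-- Of any two jobs, one is completed by the time the other one is. Hence the sum of completion
times dominates the sum over the pairs of jobs of the smaller processing time. -/
lemma sum_sum_min_le (hm : 1 ≤ m) :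
    ∑ j, ∑ i, (min (σ.p i) (σ.p j) : ℝ) ≤ 2 * (m * ∑ j, S.completion j) := by
  have h1 : ∀ i j, (min (σ.p i) (σ.p j) : ℝ) ≤
      (if S.completion i ≤ S.completion j then (σ.p i : ℝ) else 0) +
        if S.completion j ≤ S.completion i then (σ.p j : ℝ) else 0 := by
    intro i j
    have hi : (0 : ℝ) ≤ σ.p i := Nat.cast_nonneg _
    have hj : (0 : ℝ) ≤ σ.p j := Nat.cast_nonneg _
    have := min_le_left (σ.p i : ℝ) (σ.p j)
    have := min_le_right (σ.p i : ℝ) (σ.p j)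
    rcases le_total (S.completion i) (S.completion j) with h | h
    · rw [if_pos h]; split_ifs <;> linarith
    · rw [if_pos h]; split_ifs <;> linarith
  have h2 : ∑ j, ∑ i, (if S.completion i ≤ S.completion j then (σ.p i : ℝ) else 0) ≤
      m * ∑ j, S.completion j := by
    rw [Finset.mul_sum]
    refine Finset.sum_le_sum fun j _ => ?_
    rw [← Finset.sum_filter]
    exact S.sum_p_le_mul_completion hm j
  calc ∑ j, ∑ i, (min (σ.p i) (σ.p j) : ℝ)
      ≤ ∑ j, ∑ i, ((if S.completion i ≤ S.completion j then (σ.p i : ℝ) else 0) +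
        if S.completion j ≤ S.completion i then (σ.p j : ℝ) else 0) :=
        Finset.sum_le_sum fun j _ => Finset.sum_le_sum fun i _ => h1 i j
    _ = (∑ j, ∑ i, if S.completion i ≤ S.completion j then (σ.p i : ℝ) else 0) +
        ∑ i, ∑ j, if S.completion j ≤ S.completion i then (σ.p j : ℝ) else 0 := by
        simp only [Finset.sum_add_distrib]
        congr 1
        exact Finset.sum_comm
    _ ≤ 2 * (m * ∑ j, S.completion j) := by linarith

end PreemptiveSchedule

/-! ### The two competitive ratios -/

lemma two_pow_clog_le {p : ℕ} (hp : 1 ≤ p) : 2 ^ Nat.clog 2 p ≤ 2 * p := by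
  rcases hp.eq_or_lt with rfl | hp
  · simp
  have h1 := Nat.pow_pred_clog_lt_self (b := 2) (by norm_num) hp
  have h2 := Nat.clog_pos (b := 2) (by norm_num) hp
  rw [← Nat.succ_pred_eq_of_pos h2, pow_succ]
  omega

section Ratio

variable {m n : ℕ} {σ : Input n} {x : Fin n → Slot × Fin m}

lemma Input.p_le_pMax (σ : Input n) (j : Fin n) : σ.p j ≤ σ.pMax :=
  Finset.le_sup (f := σ.p) (Finset.mem_univ j)

lemma Input.clog_pMax_le (σ : Input n) (j : Fin n) :
    (Nat.clog 2 σ.pMax : ℝ) + 1 ≤ 2 * (1 + Real.logb 2 σ.pMax) := by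
  have hp : 1 ≤ σ.pMax := (σ.p_pos j).trans (σ.p_le_pMax j)
  have hp' : (1 : ℝ) ≤ σ.pMax := by exact_mod_cast hp
  have h1 : ((2 : ℝ) ^ Nat.clog 2 σ.pMax) ≤ 2 * σ.pMax := by exact_mod_cast two_pow_clog_le hp
  have h2 := Real.logb_le_logb_of_le (b := 2) (by norm_num) (by positivity) h1
  rw [Real.logb_mul (by norm_num) (by positivity), Real.logb_pow,
    Real.logb_self_eq_one (by norm_num), mul_one] at h2
  have h3 : 0 ≤ Real.logb 2 σ.pMax := Real.logb_nonneg (by norm_num) hp'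
  linarith

lemma IsRun.mul_completion_le_logb (hm : 1 ≤ m) (hx : IsRun σ x) (j : Fin n) :
    (m : ℝ) * completion σ x j ≤ 8 * (1 + Real.logb 2 σ.pMax) *
      (m * (σ.arrival j + 2 ^ σ.cls j) +
        ∑ i with i ≤ j ∧ σ.cls i ≤ σ.cls j, 2 ^ σ.cls i) := by
  have h1 := hx.mul_completion_le hm (L := Nat.clog 2 σ.pMax)
    (fun i => Nat.clog_mono_right 2 (σ.p_le_pMax i)) j
  have h2 : (m : ℝ) * completion σ x j ≤ 4 * (Nat.clog 2 σ.pMax + 1) *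
      (m * (σ.arrival j + 2 ^ σ.cls j) +
        ∑ i with i ≤ j ∧ σ.cls i ≤ σ.cls j, 2 ^ σ.cls i) := by exact_mod_cast h1
  refine h2.trans (mul_le_mul_of_nonneg_right ?_ (by positivity))
  linarith [σ.clog_pMax_le j]

lemma IsRun.completion_le_srptCompletion (hm : 1 ≤ m) (hx : IsRun σ x)
    (hr : ∀ j, ∃ a : ℕ, σ.r j = a) (hp : ∀ j, ∃ k : ℕ, σ.p j = 2 ^ k) (j : Fin n) :
    (completion σ x j : ℝ) ≤ 16 * (1 + Real.logb 2 σ.pMax) * srptCompletion m σ j := by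
  have hcls : ∀ i, 2 ^ σ.cls i = σ.p i := fun i => by
    obtain ⟨k, hk⟩ := hp i
    rw [Input.cls, hk, Nat.clog_pow 2 k (by norm_num)]
  have hle : ∀ i, σ.cls i ≤ σ.cls j ↔ σ.p i ≤ σ.p j := fun i => by
    rw [← hcls i, ← hcls j, Nat.pow_le_pow_iff_right (by norm_num)]
  obtain ⟨a, ha⟩ := hr j
  have harr : σ.arrival j = a := by rw [Input.arrival, ha, Nat.ceil_natCast]
  have h1 := hx.mul_completion_le_logb hm j
  have h2 : m * (σ.arrival j + 2 ^ σ.cls j) ≤ m * srptCompletion m σ j := by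
    rw [harr, hcls]
    exact Nat.mul_le_mul_left _ (add_p_le_srptCompletion hm ha)
  have h3 : ∑ i with i ≤ j ∧ σ.cls i ≤ σ.cls j, 2 ^ σ.cls i ≤ m * srptCompletion m σ j := by
    simp only [hle, hcls]
    exact sum_p_le_mul_srptCompletion hm j
  have h4 : (m : ℝ) * (σ.arrival j + 2 ^ σ.cls j) +
      ∑ i with i ≤ j ∧ σ.cls i ≤ σ.cls j, 2 ^ σ.cls i ≤
      m * srptCompletion m σ j + m * srptCompletion m σ j := by exact_mod_cast Nat.add_le_add h2 h3
  have hlog : (0 : ℝ) ≤ 8 * (1 + Real.logb 2 σ.pMax) := by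
    have h5 := σ.clog_pMax_le j
    have h6 : (0 : ℝ) ≤ Nat.clog 2 σ.pMax := Nat.cast_nonneg _
    linarith
  have hm' : (0 : ℝ) < m := by exact_mod_cast hm
  refine le_of_mul_le_mul_left ?_ hm'
  refine (h1.trans (mul_le_mul_of_nonneg_left h4 hlog)).trans (le_of_eq ?_)
  ring

/-- The volume that counts for the jobs of the mechanism, summed over all the jobs, is bounded by
the sum over the pairs of jobs of the smaller processing time. -/
lemma sum_sum_two_pow_cls_le (σ : Input n) :
    ∑ j, ∑ i with i ≤ j ∧ σ.cls i ≤ σ.cls j, (2 : ℝ) ^ σ.cls i ≤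
      2 * ∑ j, ∑ i, (min (σ.p i) (σ.p j) : ℝ) := by
  rw [Finset.mul_sum]
  refine Finset.sum_le_sum fun j _ => ?_
  rw [Finset.mul_sum, Finset.sum_filter]
  refine Finset.sum_le_sum fun i _ => ?_
  split_ifs with h
  · have h1 : 2 ^ σ.cls i ≤ 2 * σ.p i := two_pow_clog_le (σ.p_pos i)
    have h2 : 2 ^ σ.cls j ≤ 2 * σ.p j := two_pow_clog_le (σ.p_pos j)
    have h3 : 2 ^ σ.cls i ≤ 2 ^ σ.cls j := Nat.pow_le_pow_right (by norm_num) h.2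
    have h4 : 2 ^ σ.cls i ≤ 2 * min (σ.p i) (σ.p j) := by
      rcases min_choice (σ.p i) (σ.p j) with h | h <;> omega
    exact_mod_cast h4
  · positivity

lemma IsRun.sum_completion_le (hm : 1 ≤ m) (hx : IsRun σ x) (S : PreemptiveSchedule m σ) :
    ∑ j, (completion σ x j : ℝ) ≤
      56 * (1 + Real.logb 2 σ.pMax) * ∑ j, S.completion j := by
  rcases Nat.eq_zero_or_pos n with rfl | hn
  · simp
  have hm' : (0 : ℝ) < m := by exact_mod_cast hm
  have hlog : (0 : ℝ) ≤ 8 * (1 + Real.logb 2 σ.pMax) := by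
    have h5 := σ.clog_pMax_le ⟨0, hn⟩
    have h6 : (0 : ℝ) ≤ Nat.clog 2 σ.pMax := Nat.cast_nonneg _
    linarith
  have h1 : ∀ j, (σ.arrival j + 2 ^ σ.cls j : ℝ) ≤ 3 * S.completion j := fun j => by
    have h2 : (σ.arrival j : ℝ) < σ.r j + 1 := Nat.ceil_lt_add_one (σ.r_nonneg j)
    have h3 : (2 ^ σ.cls j : ℝ) ≤ 2 * σ.p j := by exact_mod_cast two_pow_clog_le (σ.p_pos j)
    have h4 : (1 : ℝ) ≤ σ.p j := by exact_mod_cast σ.p_pos j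
    have h5 := S.r_add_p_le_completion j
    have h6 := σ.r_nonneg j
    linarith
  have h2 : ∑ j, ((m : ℝ) * (σ.arrival j + 2 ^ σ.cls j) +
      ∑ i with i ≤ j ∧ σ.cls i ≤ σ.cls j, (2 : ℝ) ^ σ.cls i) ≤
      7 * (m * ∑ j, S.completion j) := by
    rw [Finset.sum_add_distrib, ← Finset.mul_sum]
    have h3 := Finset.sum_le_sum fun j (_ : j ∈ Finset.univ) => h1 j
    rw [← Finset.mul_sum] at h3
    have h4 := mul_le_mul_of_nonneg_left h3 hm'.le
    have h5 := sum_sum_two_pow_cls_le σ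
    have h6 := S.sum_sum_min_le hm
    linarith
  refine le_of_mul_le_mul_left ?_ hm'
  rw [Finset.mul_sum]
  refine (Finset.sum_le_sum fun j _ => hx.mul_completion_le_logb hm j).trans ?_
  rw [← Finset.mul_sum]
  refine (mul_le_mul_of_nonneg_left h2 hlog).trans (le_of_eq ?_)
  ring

end Ratio

end PromptScheduling

end

theorem mainTheorem1 :
    ∃ C : ℝ, 0 < C ∧ ∀ (m n : ℕ) (_hm : 1 ≤ m) (σ : Input n),
      -- the mechanism can be run on every input
      (∃ choice : Fin n → Slot × Fin m, IsRun σ choice) ∧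
      ∀ choice : Fin n → Slot × Fin m, IsRun σ choice →
        -- it is `O(log P_max)`-competitive against every preemptive schedule
        (∀ S : PreemptiveSchedule m σ,
          ∑ j, (completion σ choice j : ℝ) ≤
            C * (1 + Real.logb 2 (σ.pMax : ℝ)) * ∑ j, S.completion j) ∧
        -- job by job against SRPT, for integral release times and powers of two
        ((∀ j, ∃ a : ℕ, σ.r j = (a : ℝ)) → (∀ j, ∃ k : ℕ, σ.p j = 2 ^ k) →
          ∀ j, (completion σ choice j : ℝ) ≤
            C * (1 + Real.logb 2 (σ.pMax : ℝ)) * (srptCompletion m σ j : ℝ)) := by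
  refine ⟨56, by norm_num, fun m n hm σ => ⟨exists_isRun hm σ, fun choice hx =>
    ⟨fun S => hx.sum_completion_le hm S, fun hr hp j => ?_⟩⟩⟩
  refine (hx.completion_le_srptCompletion hm hr hp j).trans ?_
  have h1 := σ.clog_pMax_le j
  have h2 : (0 : ℝ) ≤ Nat.clog 2 σ.pMax := Nat.cast_nonneg _
  refine mul_le_mul_of_nonneg_right ?_ (Nat.cast_nonneg _)
  linarith
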